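/- **DatalogMTL.** The timeline is $\mathbb Q$; an interval is a nonempty interval of $\mathbb Q$ whose endpoints are rational or infinite. Ground relational atoms are $P(\mathbf c)$ with $\mathbf c$ a tuple of constants (there is at least one constant). Metric atoms are built from $\top$, $\bot$ and relational atoms (over variables and constants) with $\diamondminus_\varrho,\diamondplus_\varrho,\boxminus_\varrho,\boxplus_\varrho,\mathcal S_\varrho,\mathcal U_\varrho$, where $\varrho$ is an interval of non-negative rationals. A rule is $M'\leftarrow M_1\wedge\dots\wedge M_n$ ($n\ge1$) with metric atoms $M_i$ and $M'$ built from $\top$ or one relational atom with $\boxminus_\varrho,\boxplus_\varrho$ only. It is safe if each head variable has a body occurrence that is not in a left operand of $\mathcal S$ or $\mathcal U$. A program is a finite set of safe rules; a dataset is a finite set of facts $M@\varrho$ with $M$ a ground relational atom. An interpretation $\mathfrak I$ tells which ground relational atoms hold at which $t\in\mathbb Q$; $\mathfrak I,t\models M$ for ground metric $M$ is the usual continuous semantics: $\diamondminus_\varrho M$ holds at $t$ iff $M$ holds at some $t'$ with $t-t'\in\varrho$; $\boxminus_\varrho M$ iff $M$ holds at all such $t'$; $M_1\mathcal S_\varrho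 M_2$ iff $M_2$ holds at some such $t'$ and $M_1$ on $(t',t)$; and symmetrically ($t'-t\in\varrho$) for $\diamondplus,\boxplus,\mathcal U$. A dataset $\mathcal D$ represents its least model $\mathfrak I_{\mathcal D}$; $\mathcal D\models M@\varrho$ means that each model of $\mathcal D$ satisfies $M$ at all $t\in\varrho$. $T_\Pi(\mathfrak I)$ is the least interpretation that contains $\mathfrak I$ and satisfies the head of each ground instance of a rule of $\Pi$ at each time point at which $\mathfrak I$ satisfies its body. **Rule application.** An instance of $r=(M'\leftarrow M_1\wedge\dots\wedge M_n)$ for $\mathcal D$ is a tuple $(M_1\sigma@\varrho_1,\dots,M_n\sigma@\varrho_n)$ with $\sigma$ a substitution of constants for variables and each $\varrho_i$ a subset-maximal interval with $\mathcal D\models M_i\sigma@\varrho_i$. It is an instance relative to $\Delta$ if moreover $\mathcal D\setminus\Delta\not\models M_i\sigma@\varrho_i$ for some $i$. It derives the fact $M@\varrho$, where $M$ is the relational atom in $M'\sigma$ (if there is one) and $\varrho$ is the maximal interval for which $M'\sigma@(\varrho_1\cap\dots\cap\varrho_n)$ entails $M@\varrho$. $\Pi\langle\mathcal D\,\vdots\,\Delta\rangle$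 is the set of facts derived by the instances, relative to $\Delta$, for rules of $\Pi$ and $\mathcal D$. $\mathcal D_1\Cup\mathcal D_2$ is the set of all facts $M@\varrho$ entailed by $\mathcal D_1\cup\mathcal D_2$ such that no $M@\varrho'$ with $\varrho\subsetneq\varrho'$ is entailed. **Recursion.** The dependency graph of $\Pi$ has an edge from $Q$ to $R$ if some rule of $\Pi$ mentions $Q$ in its body and $R$ in its head. A predicate is recursive if some path contains a cycle and ends in it. A metric atom is non-recursive if all its predicates are. The recursive fragment of $\Pi$ consists of its rules with recursive heads. $S_r$ is the set of body atoms of $r$ that are non-recursive in $\Pi$. A set of rules is forward-propagating if its rules mention neither $\top$ nor $\bot$, only past operators ($\diamondminus,\boxminus,\mathcal S$) in bodies and only future operators in heads. **Procedure.** On input $\Pi,\mathcal D$, initialise $\Delta,\mathcal D':=\mathcal D$, $\Pi':=\Pi$, $\mathit{flag}:=0$ and loop: 1. $\mathcal N:=\Pi'\langle\mathcal D'\,\vdots\,\Delta\rangle$; $\mathcal C:=\mathcal D'\Cup\mathcal N$; $\Delta:=\{M@\varrho\in\mathcal C : M@\varrho$ entails some fact of $\mathcal N$ that $\mathcal D'$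 does not entail$\}$. If $\Delta=\emptyset$, return $\mathcal D'$. 2. If $\mathit{flag}=0$ and $\mathcal D',\mathcal C$ entail the same facts with non-recursive predicates, set $\mathit{flag}:=1$, let $\Pi'$ be the recursive fragment of $\Pi$, and remove from $\Pi'$ each $r$ for which some $M\in S_r$ satisfies $\mathcal D'\not\models M\sigma@t$ for all $\sigma$ and $t$. 3. If $\mathit{flag}=1$ and $\Pi'$ is forward-propagating, remove from $\Pi'$ each $r$ with $S_r\neq\emptyset$ such that $\mathcal D'$ and $\mathcal C$ entail the same facts over intervals with right endpoint at most $t_r$. Here $t_r:=\min_{M\in S_r}t^M_{\max}$ and $t^M_{\max}$ is the maximum right endpoint (possibly infinite) of the intervals $\varrho$ with $\mathcal D'\models M\sigma@\varrho$ for some $\sigma$. 4. $\mathcal D':=\mathcal C$. **Theorem (Soundness and Completeness).** Let $\Pi$ be a program such that no ground instance of a rule of $\Pi$ has a body that holds, at some time point, in the interpretation that makes all relational atoms false (so rules such as $P\leftarrow\top$ are excluded), and let $\mathcal D$ be a dataset. Run the procedure on $\Pi$ and $\mathcal D$. For every $k\in\mathbb N$, the partial materialisation $\mathcal D'$ upon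 completion of the $k$-th iteration of the loop ($\mathcal D'=\mathcal D$ for $k=0$; $\mathcal D'$ stays as returned after termination) is a (finite) dataset and represents $T_\Pi^k(\mathfrak I_{\mathcal D})$. -/

import Mathlib

namespace DatalogMTL

universe u v w x

/-! ### Syntax -/

/-- A nonempty interval of the rational timeline: an order-convex set of rationals each of whose
two endpoints is a rational number or infinite. Intervals are identified with the set of their
time points. -/
@[ext]
structure Interval where
  carrier : Set ℚ
  nonempty : carrier.Nonempty
  ordConnected : carrier.OrdConnected
  left_endpoint : BddBelow carrier → ∃ a : ℚ, IsGLB carrier a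
  right_endpoint : BddAbove carrier → ∃ b : ℚ, IsLUB carrier b

/-- The right endpoint of an interval, as an extended real number. -/
noncomputable def Interval.rightEnd (ρ : Interval) : EReal :=
  ⨆ t ∈ ρ.carrier, (((t : ℚ) : ℝ) : EReal)

/-- The intervals that index metric operators contain only non-negative rationals. -/
structure OpInterval extends Interval where
  nonneg : ∀ t ∈ carrier, 0 ≤ t

/-- A term is a variable or a constant. -/
inductive Term (V : Type u) (C : Type v) : Type (max u v)
  | var (a : V) : Term V C
  | const (c : C) : Term V C

/-- The value of a term under a substitution of constants for variables. -/
def Term.subst {V : Type u} {C : Type v} (σ : V → C) : Term V C → C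
  | .var a => σ a
  | .const c => c

/-- Relational atoms `P(s)` over terms of type `T`; an atom is ground if `T` is the type of
constants. -/
structure RAtom (Pred : Type u) (T : Type v) where
  pred : Pred
  args : List T

/-- Metric atoms over terms of type `T`. -/
inductive MAtom (Pred : Type u) (T : Type v) : Type (max u v)
  | top : MAtom Pred T
  | bot : MAtom Pred T
  | rel (a : RAtom Pred T) : MAtom Pred T
  | diamondMinus (ρ : OpInterval) (M : MAtom Pred T) : MAtom Pred T
  | diamondPlus (ρ : OpInterval) (M : MAtom Pred T) : MAtom Pred T
  | boxMinus (ρ : OpInterval) (M : MAtom Pred T) : MAtom Pred T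
  | boxPlus (ρ : OpInterval) (M : MAtom Pred T) : MAtom Pred T
  | since (ρ : OpInterval) (M₁ M₂ : MAtom Pred T) : MAtom Pred T
  | until (ρ : OpInterval) (M₁ M₂ : MAtom Pred T) : MAtom Pred T

/-- The metric atoms allowed in rule heads. -/
inductive HAtom (Pred : Type u) (T : Type v) : Type (max u v)
  | top : HAtom Pred T
  | rel (a : RAtom Pred T) : HAtom Pred T
  | boxMinus (ρ : OpInterval) (M : HAtom Pred T) : HAtom Pred T
  | boxPlus (ρ : OpInterval) (M : HAtom Pred T) : HAtom Pred T

def HAtom.toMAtom {Pred : Type u} {T : Type v} : HAtom Pred T → MAtom Pred T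
  | .top => .top
  | .rel a => .rel a
  | .boxMinus ρ M => .boxMinus ρ M.toMAtom
  | .boxPlus ρ M => .boxPlus ρ M.toMAtom

/-- The relational atom in a head, if there is one (there is none if the head is built
from `⊤`). -/
def HAtom.relAtom {Pred : Type u} {T : Type v} : HAtom Pred T → Option (RAtom Pred T)
  | .top => none
  | .rel a => some a
  | .boxMinus _ M => M.relAtom
  | .boxPlus _ M => M.relAtom

def RAtom.map {Pred : Type u} {S : Type v} {T : Type w} (f : S → T) (a : RAtom Pred S) :
    RAtom Pred T :=
  ⟨a.pred, a.args.map f⟩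

def MAtom.map {Pred : Type u} {S : Type v} {T : Type w} (f : S → T) :
    MAtom Pred S → MAtom Pred T
  | .top => .top
  | .bot => .bot
  | .rel a => .rel (a.map f)
  | .diamondMinus ρ M => .diamondMinus ρ (M.map f)
  | .diamondPlus ρ M => .diamondPlus ρ (M.map f)
  | .boxMinus ρ M => .boxMinus ρ (M.map f)
  | .boxPlus ρ M => .boxPlus ρ (M.map f)
  | .since ρ M₁ M₂ => .since ρ (M₁.map f) (M₂.map f)
  | .until ρ M₁ M₂ => .until ρ (M₁.map f) (M₂.map f)

def HAtom.map {Pred : Type u} {S : Type v} {T : Type w} (f : S → T) :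
    HAtom Pred S → HAtom Pred T
  | .top => .top
  | .rel a => .rel (a.map f)
  | .boxMinus ρ M => .boxMinus ρ (M.map f)
  | .boxPlus ρ M => .boxPlus ρ (M.map f)

/-- The ground metric atom `Mσ`. -/
def MAtom.subst {Pred : Type u} {V : Type v} {C : Type w} (σ : V → C)
    (M : MAtom Pred (Term V C)) : MAtom Pred C :=
  M.map (Term.subst σ)

/-- The ground head `M'σ`. -/
def HAtom.subst {Pred : Type u} {V : Type v} {C : Type w} (σ : V → C)
    (M : HAtom Pred (Term V C)) : HAtom Pred C :=
  M.map (Term.subst σ)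

/-- The predicates mentioned in a metric atom. -/
def MAtom.preds {Pred : Type u} {T : Type v} : MAtom Pred T → Set Pred
  | .top => ∅
  | .bot => ∅
  | .rel a => {a.pred}
  | .diamondMinus _ M => M.preds
  | .diamondPlus _ M => M.preds
  | .boxMinus _ M => M.preds
  | .boxPlus _ M => M.preds
  | .since _ M₁ M₂ => M₁.preds ∪ M₂.preds
  | .until _ M₁ M₂ => M₁.preds ∪ M₂.preds

/-- The variables of a relational atom. -/
def RAtom.vars {Pred : Type u} {V : Type v} {C : Type w} (a : RAtom Pred (Term V C)) : Set V :=
  {y | Term.var y ∈ a.args}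

/-- The variables with an occurrence in `M` that is not in a left operand of `𝓢` or `𝓤`. -/
def MAtom.safeVars {Pred : Type u} {V : Type v} {C : Type w} :
    MAtom Pred (Term V C) → Set V
  | .top => ∅
  | .bot => ∅
  | .rel a => a.vars
  | .diamondMinus _ M => M.safeVars
  | .diamondPlus _ M => M.safeVars
  | .boxMinus _ M => M.safeVars
  | .boxPlus _ M => M.safeVars
  | .since _ _ M₂ => M₂.safeVars
  | .until _ _ M₂ => M₂.safeVars

/-- The variables of a rule head. -/
def HAtom.vars {Pred : Type u} {V : Type v} {C : Type w} : HAtom Pred (Term V C) → Set V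
  | .top => ∅
  | .rel a => a.vars
  | .boxMinus _ M => M.vars
  | .boxPlus _ M => M.vars

/-- A rule `M' ← M₁ ∧ … ∧ Mₙ` with `n ≥ 1`. -/
structure Rule (Pred : Type u) (V : Type v) (C : Type w) where
  head : HAtom Pred (Term V C)
  body : List (MAtom Pred (Term V C))
  body_ne : body ≠ []

/-- Each head variable has an occurrence in the body that is not in a left operand of `𝓢`
or `𝓤`. -/
def Rule.Safe {Pred : Type u} {V : Type v} {C : Type w} (r : Rule Pred V C) : Prop :=
  ∀ y ∈ r.head.vars, ∃ M ∈ r.body, y ∈ M.safeVars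

/-- A program is a finite set of safe rules. -/
def IsProgram {Pred : Type u} {V : Type v} {C : Type w} (P : Set (Rule Pred V C)) : Prop :=
  P.Finite ∧ ∀ r ∈ P, r.Safe

/-- No mention of `⊤`, `⊥` or a future operator. -/
def MAtom.PastOnly {Pred : Type u} {T : Type v} : MAtom Pred T → Prop
  | .top => False
  | .bot => False
  | .rel _ => True
  | .diamondMinus _ M => M.PastOnly
  | .diamondPlus _ _ => False
  | .boxMinus _ M => M.PastOnly
  | .boxPlus _ _ => False
  | .since _ M₁ M₂ => M₁.PastOnly ∧ M₂.PastOnly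
  | .until _ _ _ => False

/-- No mention of `⊤` or a past operator. -/
def HAtom.FutureOnly {Pred : Type u} {T : Type v} : HAtom Pred T → Prop
  | .top => False
  | .rel _ => True
  | .boxMinus _ _ => False
  | .boxPlus _ M => M.FutureOnly

/-- Forward-propagating sets of rules. -/
def ForwardPropagating {Pred : Type u} {V : Type v} {C : Type w}
    (P : Set (Rule Pred V C)) : Prop :=
  ∀ r ∈ P, r.head.FutureOnly ∧ ∀ M ∈ r.body, M.PastOnly

/-- A fact `M@ρ` with `M` a ground relational atom. -/
structure Fact (Pred : Type u) (C : Type v) where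
  atom : RAtom Pred C
  ivl : Interval

/-- An expression `M@ρ` with `M` a ground metric atom. -/
structure MFact (Pred : Type u) (C : Type v) where
  atom : MAtom Pred C
  ivl : Interval

/-! ### Semantics -/

/-- An interpretation says which ground relational atoms hold at which time points. The order is
inclusion, the least element `⊥` makes every relational atom false everywhere. -/
abbrev Interp (Pred : Type u) (C : Type v) : Type (max u v) := RAtom Pred C → ℚ → Prop

/-- `Sat I M t` is `I, t ⊨ M`. -/
def Sat {Pred : Type u} {C : Type v} (I : Interp Pred C) : MAtom Pred C → ℚ → Prop
  | .top, _ => True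
  | .bot, _ => False
  | .rel a, t => I a t
  | .diamondMinus ρ M, t => ∃ t', t - t' ∈ ρ.carrier ∧ Sat I M t'
  | .diamondPlus ρ M, t => ∃ t', t' - t ∈ ρ.carrier ∧ Sat I M t'
  | .boxMinus ρ M, t => ∀ t', t - t' ∈ ρ.carrier → Sat I M t'
  | .boxPlus ρ M, t => ∀ t', t' - t ∈ ρ.carrier → Sat I M t'
  | .since ρ M₁ M₂, t =>
      ∃ t', t - t' ∈ ρ.carrier ∧ Sat I M₂ t' ∧ ∀ t'' ∈ Set.Ioo t' t, Sat I M₁ t''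
  | .until ρ M₁ M₂, t =>
      ∃ t', t' - t ∈ ρ.carrier ∧ Sat I M₂ t' ∧ ∀ t'' ∈ Set.Ioo t t', Sat I M₁ t''

/-- `I` is a model of the dataset `D`. -/
def ModelsData {Pred : Type u} {C : Type v} (I : Interp Pred C) (D : Set (Fact Pred C)) : Prop :=
  ∀ f ∈ D, ∀ t ∈ f.ivl.carrier, I f.atom t

/-- `D ⊨ M@ρ` for a ground metric atom `M`: every model of `D` satisfies `M` throughout `ρ`. -/
def Entails {Pred : Type u} {C : Type v} (D : Set (Fact Pred C)) (M : MAtom Pred C)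
    (ρ : Interval) : Prop :=
  ∀ I : Interp Pred C, ModelsData I D → ∀ t ∈ ρ.carrier, Sat I M t

/-- The dataset `D` represents `I`: `I` is the least model of `D`. -/
def Represents {Pred : Type u} {C : Type v} (D : Set (Fact Pred C)) (I : Interp Pred C) : Prop :=
  IsLeast {J : Interp Pred C | ModelsData J D} I

/-- The least model `𝕴_D` of the dataset `D`. -/
def leastModel {Pred : Type u} {C : Type v} (D : Set (Fact Pred C)) : Interp Pred C :=
  fun a t => ∃ f ∈ D, f.atom = a ∧ t ∈ f.ivl.carrier

theorem represents_leastModel {Pred : Type u} {C : Type v} (D : Set (Fact Pred C)) :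
    Represents D (leastModel D) := by
  refine ⟨fun f hf t ht => ⟨f, hf, rfl, ht⟩, ?_⟩
  rintro J hJ a t ⟨f, hf, rfl, ht⟩
  exact hJ f hf t ht

/-- `J` satisfies the head of every ground rule instance at every time point at which `I` satisfies
all body atoms of that instance. -/
def ClosedUnder {Pred : Type u} {V : Type v} {C : Type w} (P : Set (Rule Pred V C))
    (I J : Interp Pred C) : Prop :=
  ∀ r ∈ P, ∀ (σ : V → C) (t : ℚ), (∀ M ∈ r.body, Sat I (M.subst σ) t) →
    Sat J (r.head.subst σ).toMAtom t

/-- The immediate consequence operator `T_Π`: the least interpretation that contains `I` and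
satisfies the rule heads whose bodies hold in `I`. -/
def immediateConsequence {Pred : Type u} {V : Type v} {C : Type w} (P : Set (Rule Pred V C))
    (I : Interp Pred C) : Interp Pred C :=
  sInf {J : Interp Pred C | I ≤ J ∧ ClosedUnder P I J}

theorem sat_head_sInf {Pred : Type u} {C : Type v} (S : Set (Interp Pred C))
    (H : HAtom Pred C) (t : ℚ) (h : ∀ J ∈ S, Sat J H.toMAtom t) :
    Sat (sInf S) H.toMAtom t := by
  induction H generalizing t with
  | top => trivial
  | rel a =>
    simp only [HAtom.toMAtom, Sat] at h ⊢
    simp only [sInf_apply, iInf_apply, iInf_Prop_eq]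
    rintro ⟨J, hJ⟩
    exact h J hJ
  | boxMinus ρ M ih => exact fun t' ht' => ih t' fun J hJ => h J hJ t' ht'
  | boxPlus ρ M ih => exact fun t' ht' => ih t' fun J hJ => h J hJ t' ht'

theorem isLeast_immediateConsequence {Pred : Type u} {V : Type v} {C : Type w}
    (P : Set (Rule Pred V C)) (I : Interp Pred C) :
    IsLeast {J : Interp Pred C | I ≤ J ∧ ClosedUnder P I J} (immediateConsequence P I) := by
  refine ⟨⟨le_sInf fun J hJ => hJ.1, ?_⟩, fun J hJ => sInf_le hJ⟩
  intro r hr σ t hb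
  exact sat_head_sInf _ _ _ fun J hJ => hJ.2 r hr σ t hb

/-! ### Rule application and coalescing -/

/-- `ρ` is a subset-maximal interval with the property `p`. -/
def IsMaximalInterval (p : Interval → Prop) (ρ : Interval) : Prop :=
  p ρ ∧ ∀ ρ' : Interval, p ρ' → ρ.carrier ⊆ ρ'.carrier → ρ' = ρ

/-- The instances `(M₁σ@ρ₁, …, Mₙσ@ρₙ)` for `r` and `D`, where each `ρᵢ` is a subset-maximal
interval with `D ⊨ Mᵢσ@ρᵢ`. -/
def instances {Pred : Type u} {V : Type v} {C : Type w} (r : Rule Pred V C)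
    (D : Set (Fact Pred C)) : Set (Fin r.body.length → MFact Pred C) :=
  {e | ∃ σ : V → C, ∀ i, (e i).atom = (r.body.get i).subst σ ∧
    IsMaximalInterval (Entails D ((r.body.get i).subst σ)) (e i).ivl}

/-- The instances for `r` and `D` relative to `Δ`: those that cannot be obtained by using only
facts of `D \ Δ`. -/
def relInstances {Pred : Type u} {V : Type v} {C : Type w} (r : Rule Pred V C)
    (D Δ : Set (Fact Pred C)) : Set (Fin r.body.length → MFact Pred C) :=
  {e ∈ instances r D | ∃ i, ¬ Entails (D \ Δ) (e i).atom (e i).ivl}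

/-- The facts derived by `r` from a set `E` of instances: for an instance
`(M₁σ@ρ₁, …, Mₙσ@ρₙ)` in `E`, the fact `M@ρ` with `M` the relational atom in `M'σ` and `ρ` the
subset-maximal interval for which `M'σ@(ρ₁ ∩ … ∩ ρₙ)` entails `M@ρ`. -/
def derive {Pred : Type u} {V : Type v} {C : Type w} (r : Rule Pred V C)
    (E : Set (Fin r.body.length → MFact Pred C)) : Set (Fact Pred C) :=
  {f | ∃ (σ : V → C) (ρ : Fin r.body.length → Interval),
    (r.head.subst σ).relAtom = some f.atom ∧
    (fun i => (⟨(r.body.get i).subst σ, ρ i⟩ : MFact Pred C)) ∈ E ∧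
    IsMaximalInterval
      (fun ρ' => ∀ I : Interp Pred C,
        (∀ t ∈ ⋂ i, (ρ i).carrier, Sat I (r.head.subst σ).toMAtom t) →
          ∀ t ∈ ρ'.carrier, I f.atom t)
      f.ivl}

/-- The facts derived from `D` relative to `Δ` by one-step application of the rules in `P`. -/
def relDerived {Pred : Type u} {V : Type v} {C : Type w} (P : Set (Rule Pred V C))
    (D Δ : Set (Fact Pred C)) : Set (Fact Pred C) :=
  {f | ∃ r ∈ P, f ∈ derive r (relInstances r D Δ)}

/-- The coalescing operator: all facts `M@ρ` entailed by `D₁ ∪ D₂` such that no `M@ρ'` with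
`ρ ⊊ ρ'` is entailed. -/
def coalesce {Pred : Type u} {C : Type v} (D₁ D₂ : Set (Fact Pred C)) : Set (Fact Pred C) :=
  {f | Entails (D₁ ∪ D₂) (.rel f.atom) f.ivl ∧
    ∀ ρ' : Interval, f.ivl.carrier ⊂ ρ'.carrier → ¬ Entails (D₁ ∪ D₂) (.rel f.atom) ρ'}

/-- The facts of `N` that are not entailed by `D`. -/
def newFacts {Pred : Type u} {C : Type v} (N D : Set (Fact Pred C)) : Set (Fact Pred C) :=
  {f ∈ N | ¬ Entails D (.rel f.atom) f.ivl}

/-! ### Recursive predicates -/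

/-- The edges of the dependency graph: `Q` occurs in the body and `R` in the head of a rule. -/
def DepEdge {Pred : Type u} {V : Type v} {C : Type w} (P : Set (Rule Pred V C))
    (Q R : Pred) : Prop :=
  ∃ r ∈ P, (∃ M ∈ r.body, Q ∈ M.preds) ∧ R ∈ r.head.toMAtom.preds

/-- A predicate is recursive if some path of the dependency graph contains a cycle and ends
in it. -/
def RecursivePred {Pred : Type u} {V : Type v} {C : Type w} (P : Set (Rule Pred V C))
    (R : Pred) : Prop :=
  ∃ Q, Relation.TransGen (DepEdge P) Q Q ∧ Relation.ReflTransGen (DepEdge P) Q R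

/-- A metric atom is non-recursive if so are all its predicates. -/
def NonRecursiveAtom {Pred : Type u} {V : Type v} {C : Type w} (P : Set (Rule Pred V C))
    {T : Type x} (M : MAtom Pred T) : Prop :=
  ∀ Q ∈ M.preds, ¬ RecursivePred P Q

/-- The rules with recursive atoms in heads. -/
def recursiveFragment {Pred : Type u} {V : Type v} {C : Type w} (P : Set (Rule Pred V C)) :
    Set (Rule Pred V C) :=
  {r ∈ P | ¬ NonRecursiveAtom P r.head.toMAtom}

/-- The set `S_r` of the body atoms of `r` that are non-recursive in `P`. -/
def nonRecursiveBody {Pred : Type u} {V : Type v} {C : Type w} (P : Set (Rule Pred V C))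
    (r : Rule Pred V C) : Set (MAtom Pred (Term V C)) :=
  {M | M ∈ r.body ∧ NonRecursiveAtom P M}

/-! ### The optimised seminaïve procedure -/

/-- The variables of the procedure that are passed from one iteration of the loop to the next;
`halted` records that the procedure has returned. -/
structure State (Pred : Type u) (V : Type v) (C : Type w) where
  data : Set (Fact Pred C)
  delta : Set (Fact Pred C)
  rules : Set (Rule Pred V C)
  flag : Prop
  halted : Prop

/-- Initialisation on input `P` and `D`. -/
def initState {Pred : Type u} {V : Type v} {C : Type w} (P : Set (Rule Pred V C))
    (D : Set (Fact Pred C)) : State Pred V C where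
  data := D
  delta := D
  rules := P
  flag := False
  halted := False

/-- `D₁` and `D₂` entail the same facts with predicates that are non-recursive in `P`. -/
def SameNonRecursiveFacts {Pred : Type u} {V : Type v} {C : Type w} (P : Set (Rule Pred V C))
    (D₁ D₂ : Set (Fact Pred C)) : Prop :=
  ∀ f : Fact Pred C, ¬ RecursivePred P f.atom.pred →
    (Entails D₁ (.rel f.atom) f.ivl ↔ Entails D₂ (.rel f.atom) f.ivl)

/-- Some atom of `S_r` has no grounding that is entailed by `D` at some time point. -/
def Inapplicable {Pred : Type u} {V : Type v} {C : Type w} (P : Set (Rule Pred V C))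
    (D : Set (Fact Pred C)) (r : Rule Pred V C) : Prop :=
  ∃ M ∈ nonRecursiveBody P r, ∀ (σ : V → C) (t : ℚ),
    ¬ ∀ I : Interp Pred C, ModelsData I D → Sat I (M.subst σ) t

/-- The maximum `t_max^M` of the right endpoints of the intervals `ρ` with `D ⊨ Mσ@ρ` for some
substitution `σ`. -/
noncomputable def maxEnd {Pred : Type u} {V : Type v} {C : Type w} (D : Set (Fact Pred C))
    (M : MAtom Pred (Term V C)) : EReal :=
  sSup {e | ∃ (σ : V → C) (ρ : Interval), Entails D (M.subst σ) ρ ∧ e = ρ.rightEnd}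

/-- The minimum `t_r` of the values `t_max^M` for `M` in `S_r`. -/
noncomputable def ruleBound {Pred : Type u} {V : Type v} {C : Type w} (P : Set (Rule Pred V C))
    (D : Set (Fact Pred C)) (r : Rule Pred V C) : EReal :=
  sInf {e | ∃ M ∈ nonRecursiveBody P r, e = maxEnd D M}

/-- The loop over the atoms in `S_r` discards `r`: `S_r` is not empty, and `D` and `D'` coincide on
all facts over intervals with right endpoint at most `t_r`. -/
def Completed {Pred : Type u} {V : Type v} {C : Type w} (P : Set (Rule Pred V C))
    (D D' : Set (Fact Pred C)) (r : Rule Pred V C) : Prop :=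
  (nonRecursiveBody P r).Nonempty ∧
    ∀ f : Fact Pred C, f.ivl.rightEnd ≤ ruleBound P D r →
      (Entails D (.rel f.atom) f.ivl ↔ Entails D' (.rel f.atom) f.ivl)

open Classical in
/-- One iteration of the main loop on input program `P`. If the set `Δ` computed in the iteration is
empty, the procedure returns `D'`, which does not change from then on. -/
noncomputable def step {Pred : Type u} {V : Type v} {C : Type w} (P : Set (Rule Pred V C))
    (s : State Pred V C) : State Pred V C :=
  if s.halted then s else
  let N := relDerived s.rules s.data s.delta
  let Cs := coalesce s.data N
  let Δ : Set (Fact Pred C) :=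
    {f ∈ Cs | ∃ g ∈ newFacts N s.data, Entails {f} (.rel g.atom) g.ivl}
  if Δ = ∅ then { s with halted := True } else
  let switch : Prop := ¬ s.flag ∧ SameNonRecursiveFacts P s.data Cs
  let flag₁ : Prop := s.flag ∨ switch
  let rules₁ : Set (Rule Pred V C) :=
    if switch then {r ∈ recursiveFragment P | ¬ Inapplicable P s.data r} else s.rules
  let rules₂ : Set (Rule Pred V C) :=
    if flag₁ ∧ ForwardPropagating rules₁ then {r ∈ rules₁ | ¬ Completed P s.data Cs r}
    else rules₁
  { data := Cs, delta := Δ, rules := rules₂, flag := flag₁, halted := False }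

/-- The state of the procedure on input `P` and `D` upon completion of the `k`th iteration. -/
noncomputable def run {Pred : Type u} {V : Type v} {C : Type w} (P : Set (Rule Pred V C))
    (D : Set (Fact Pred C)) (k : ℕ) : State Pred V C :=
  (step P)^[k] (initState P D)

/-- The body of `r` is vacuous if some ground instance of it holds at some time point in the
interpretation that makes all relational atoms false. -/
def Rule.VacuousBody {Pred : Type u} {V : Type v} {C : Type w} (r : Rule Pred V C) : Prop :=
  ∃ (σ : V → C) (t : ℚ), ∀ M ∈ r.body, Sat (⊥ : Interp Pred C) (M.subst σ) t

end DatalogMTL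

/-! Write `iter P D k` for the `k`-fold application of the immediate consequence operator to the
least model of `D`. Two independent arguments are combined.

The first makes rule application and coalescing exact. Every set of time points that arises is a
union of cells of a finite rational subdivision of the timeline (`TameAt`). Such sets are closed
under Boolean operations and Minkowski sums, hence under all metric operators, and the subdivision
can be chosen independently of the substitution (`UniformlyTame.exists_tameAt_sat`,
`UniformlyTame.conseq`). Therefore maximal intervals exist with rational or infinite endpoints, each
rule instance derives one interval, and coalescing preserves the least model. By safety only
finitely many ground atoms ever hold, so coalesced datasets are finite.

The second is a loop invariant (`Invariant`): the data represent `iter P D k`, consequences of the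
current rules on `data \ delta` are already in `iter P D k`, and every discarded rule is
`Exhausted`, i.e. derives nothing new from now on. A consequence of `iter P D k` thus comes from an
exhausted rule, from old facts, or from an instance relative to `delta`; so one iteration computes
`iter P D (k + 1)` (`Invariant.leastModel_union`).

Discarding is justified by two stability facts. Rules with non-recursive heads have non-recursive
bodies, so one step without new non-recursive facts freezes the non-recursive part forever
(`agreeNonRecursive_iter`). In the forward-propagating case, the timeline up to `t_r` is frozen too
once one step leaves it unchanged, and `r` cannot fire after `t_r` (`exhausted_of_completed`). -/

namespace DatalogMTL

open scoped Pointwise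

/-! ### Tame sets of rationals -/

/-- `x` and `y` compare in the same way with each element of `F`. -/
def SameCell (F : Finset ℚ) (x y : ℚ) : Prop :=
  ∀ f ∈ F, (f ≤ x ↔ f ≤ y) ∧ (x ≤ f ↔ y ≤ f)

theorem SameCell.symm {F : Finset ℚ} {x y : ℚ} (h : SameCell F x y) : SameCell F y x :=
  fun f hf => ⟨(h f hf).1.symm, (h f hf).2.symm⟩

theorem SameCell.mono {F G : Finset ℚ} {x y : ℚ} (h : SameCell G x y) (hFG : F ⊆ G) :
    SameCell F x y :=
  fun f hf => h f (hFG hf)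

theorem sameCell_of_le {F : Finset ℚ} {x y : ℚ} (hxy : x ≤ y)
    (h : ∀ f ∈ F, x ≤ f → f ≤ y → False) : SameCell F x y := by
  intro f hf
  have := h f hf
  refine ⟨⟨fun h => h.trans hxy, fun h1 => ?_⟩, ⟨fun h1 => ?_, fun h => hxy.trans h⟩⟩
  · by_contra h2
    exact this (le_of_not_ge h2) h1
  · by_contra h2
    exact this h1 (le_of_not_ge h2)

theorem SameCell.of_mem_uIcc {F : Finset ℚ} {x y z : ℚ} (h : SameCell F x y)
    (hz : z ∈ Set.uIcc x y) : SameCell F x z := by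
  intro f hf
  obtain ⟨h1, h2⟩ := h f hf
  rcases Set.mem_uIcc.1 hz with hz | hz <;> constructor <;> constructor <;> intro h3 <;>
    first
    | linarith
    | (have := h1.1 (by linarith); linarith)
    | (have := h1.2 (by linarith); linarith)
    | (have := h2.1 (by linarith); linarith)
    | (have := h2.2 (by linarith); linarith)

/-- `S` is a union of cells of the subdivision of the timeline at the points of `F`. -/
def TameAt (F : Finset ℚ) (S : Set ℚ) : Prop :=
  ∀ x y, SameCell F x y → x ∈ S → y ∈ S

theorem TameAt.mono {F G : Finset ℚ} {S : Set ℚ} (h : TameAt F S) (hFG : F ⊆ G) : TameAt G S :=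
  fun x y hxy => h x y (hxy.mono hFG)

theorem TameAt.compl {F : Finset ℚ} {S : Set ℚ} (h : TameAt F S) : TameAt F Sᶜ :=
  fun x y hxy hx hy => hx (h y x hxy.symm hy)

theorem TameAt.inter {F : Finset ℚ} {S R : Set ℚ} (hS : TameAt F S) (hR : TameAt F R) :
    TameAt F (S ∩ R) :=
  fun x y hxy hx => ⟨hS x y hxy hx.1, hR x y hxy hx.2⟩

theorem TameAt.union {F : Finset ℚ} {S R : Set ℚ} (hS : TameAt F S) (hR : TameAt F R) :
    TameAt F (S ∪ R) :=
  fun x y hxy hx => hx.imp (hS x y hxy) (hR x y hxy)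

/-- The index type may be infinite because all members share the subdivision `F`; this pays for
keeping `F` explicit. -/
theorem TameAt.exists {ι : Sort*} {F : Finset ℚ} {p : ι → ℚ → Prop}
    (h : ∀ i, TameAt F {t | p i t}) : TameAt F {t | ∃ i, p i t} :=
  fun x y hxy ⟨i, hi⟩ => ⟨i, h i x y hxy hi⟩

theorem TameAt.forall {ι : Sort*} {F : Finset ℚ} {p : ι → ℚ → Prop}
    (h : ∀ i, TameAt F {t | p i t}) : TameAt F {t | ∀ i, p i t} :=
  fun x y hxy hx i => h i x y hxy (hx i)

theorem TameAt.neg {F : Finset ℚ} {S : Set ℚ} (h : TameAt F S) : TameAt (-F) (-S) := by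
  intro x y hxy hx
  refine h (-x) (-y) (fun f hf => ?_) hx
  obtain ⟨h1, h2⟩ := hxy (-f) (Finset.neg_mem_neg hf)
  exact ⟨by rw [le_neg, h2, le_neg], by rw [neg_le, h1, neg_le]⟩

/-- Write `x = s + r` and push `s` or `r` to the right until the sum is `y`. If one of them can
absorb the whole shift without meeting a breakpoint, move it alone. Otherwise let `f` and `g` be the
first breakpoints at or after `s` and `r`. As `f + g` is a breakpoint of the sum with `x ≤ f + g`,
also `y ≤ f + g`. -/
theorem TameAt.add_of_le {F G : Finset ℚ} {S R : Set ℚ} (hS : TameAt F S) (hR : TameAt G R)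
    {x y : ℚ} (hxy : SameCell (F + G) x y) (hle : x ≤ y) (hx : x ∈ S + R) : y ∈ S + R := by
  classical
  obtain ⟨s, hs, r, hr, rfl⟩ := hx
  simp only at hxy hle
  by_cases hF : (F.filter fun f => s ≤ f ∧ f ≤ y - r).Nonempty
  swap
  · refine ⟨y - r, hS s _ (sameCell_of_le (by linarith) fun f hf h1 h2 => hF ⟨f, ?_⟩) hs, r, hr,
      by simp⟩
    simp [hf, h1, h2]
  by_cases hG : (G.filter fun g => r ≤ g ∧ g ≤ y - s).Nonempty
  swap
  · refine ⟨s, hs, y - s, hR r _ (sameCell_of_le (by linarith) fun f hf h1 h2 => hG ⟨f, ?_⟩) hr,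
      by simp⟩
    simp [hf, h1, h2]
  obtain ⟨f, hf, hfmin⟩ := Finset.exists_min_image _ id hF
  obtain ⟨g, hg, hgmin⟩ := Finset.exists_min_image _ id hG
  simp only [Finset.mem_filter, id, and_imp] at hf hg hfmin hgmin
  obtain ⟨hfF, hf1, hf2⟩ := hf
  obtain ⟨hgG, hg1, hg2⟩ := hg
  obtain ⟨h1, h2⟩ := hxy (f + g) (Finset.add_mem_add hfF hgG)
  have h3 : y ≤ f + g := h2.1 (by linarith)
  rcases h3.eq_or_lt with h4 | h4
  · have h5 : f + g ≤ s + r := h1.2 h4.symm.le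
    have h6 : y = s + r := by linarith
    rw [h6]
    exact Set.add_mem_add hs hr
  -- Since `y - g < f`, the midpoint of `y - g` and `f` stays in `[s, f)`; the complementary summand
  -- is the midpoint of `y - f` and `g`, which stays in `[r, g)`.
  · refine ⟨(y - g + f) / 2, hS s _ (sameCell_of_le (by linarith) fun f' hf' h5 h6 => ?_) hs,
      y - (y - g + f) / 2, hR r _ (sameCell_of_le (by linarith) fun g' hg' h5 h6 => ?_) hr,
      by simp⟩
    · have := hfmin f' hf' h5 (by linarith)
      linarith
    · have := hgmin g' hg' h5 (by linarith)
      linarith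

theorem TameAt.add {F G : Finset ℚ} {S R : Set ℚ} (hS : TameAt F S) (hR : TameAt G R) :
    TameAt (F + G) (S + R) := by
  intro x y hxy hx
  rcases le_total x y with h | h
  · exact hS.add_of_le hR hxy h hx
  · have h1 : -y ∈ -S + -R := by
      refine hS.neg.add_of_le hR.neg (x := -x) ?_ (by linarith) ?_
      · intro f hf
        obtain ⟨a, ha, b, hb, rfl⟩ := Finset.mem_add.1 hf
        obtain ⟨h1, h2⟩ := hxy (-a + -b)
          (Finset.add_mem_add (Finset.mem_neg'.1 ha) (Finset.mem_neg'.1 hb))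
        rw [← neg_add] at h1 h2
        exact ⟨by rw [le_neg, h2, le_neg], by rw [neg_le, h1, neg_le]⟩
      · obtain ⟨s, hs, r, hr, rfl⟩ := hx
        exact ⟨-s, by simpa using hs, -r, by simpa using hr, by simp [add_comm]⟩
    obtain ⟨s, hs, r, hr, h2⟩ := h1
    exact ⟨-s, hs, -r, hr, by simp only at h2 ⊢; linarith⟩

/-- A cell is coded by the breakpoints at or below it and those at or above it, and a tame set is
determined by the codes of its cells. -/
theorem finite_tameAt (F : Finset ℚ) : {S : Set ℚ | TameAt F S}.Finite := by
  classical
  let c : ℚ → Finset ℚ × Finset ℚ := fun x => (F.filter (· ≤ x), F.filter (x ≤ ·))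
  have hc : ∀ x y, c x = c y → SameCell F x y := by
    intro x y h f hf
    obtain ⟨h1, h2⟩ := Prod.ext_iff.1 h
    have h1 := Finset.ext_iff.1 h1 f
    have h2 := Finset.ext_iff.1 h2 f
    simp only [c, Finset.mem_filter, hf, true_and] at h1 h2
    exact ⟨h1, h2⟩
  refine Set.Finite.of_finite_image (f := fun S => c '' S)
    (((F.powerset ×ˢ F.powerset).finite_toSet.powerset).subset ?_) ?_
  · rintro _ ⟨S, -, rfl⟩ _ ⟨x, -, rfl⟩
    simp only [c, Finset.coe_product, Set.mem_prod, Finset.mem_coe, Finset.mem_powerset]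
    exact ⟨Finset.filter_subset _ _, Finset.filter_subset _ _⟩
  · have key : ∀ S T : Set ℚ, TameAt F T → c '' S = c '' T → S ⊆ T := by
      intro S T hT h x hx
      obtain ⟨y, hy, hyx⟩ := (h ▸ ⟨x, hx, rfl⟩ : c x ∈ c '' T)
      exact hT y x (hc _ _ hyx) hy
    exact fun S hS T hT h => (key S T hT h).antisymm (key T S hS h.symm)

/-- Choose `y ∈ S` with the fewest breakpoints at or below it. These breakpoints lie below all of
`S`; the largest is the infimum, since the cell of `y` extends down to it. If there are none, the
cell of `y` is unbounded below. -/
theorem TameAt.exists_isGLB {F : Finset ℚ} {S : Set ℚ} (h : TameAt F S) (hne : S.Nonempty)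
    (hb : BddBelow S) : ∃ a, IsGLB S a := by
  classical
  obtain ⟨y, hy, hmin⟩ : ∃ y ∈ S, ∀ z ∈ S, (F.filter (· ≤ y)).card ≤ (F.filter (· ≤ z)).card := by
    obtain ⟨y, hy⟩ := exists_minimalFor_of_wellFoundedLT (· ∈ S)
      (fun y => (F.filter (· ≤ y)).card) hne
    exact ⟨y, hy.1, fun z hz => by
      rcases le_total (F.filter (· ≤ z)).card (F.filter (· ≤ y)).card with h1 | h1
      · exact hy.2 hz h1
      · exact h1⟩
  have hlow : ∀ z ∈ S, ∀ f ∈ F, f ≤ y → f ≤ z := by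
    intro z hz f hf hfy
    by_contra hfz
    have hzy : z ≤ y := by linarith
    have hss : F.filter (· ≤ z) ⊂ F.filter (· ≤ y) := by
      refine Finset.ssubset_iff_subset_ne.2 ⟨fun g hg => ?_, fun he => ?_⟩
      · simp only [Finset.mem_filter] at hg ⊢
        exact ⟨hg.1, hg.2.trans hzy⟩
      · have : f ∈ F.filter (· ≤ z) := he ▸ by simp [hf, hfy]
        simp [hf, hfz] at this
    exact absurd (hmin z hz) (not_le.2 (Finset.card_lt_card hss))
  by_cases hF : (F.filter (· ≤ y)).Nonempty
  · obtain ⟨a, ha, hamax⟩ := Finset.exists_max_image _ id hF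
    simp only [Finset.mem_filter, id, and_imp] at ha hamax
    refine ⟨a, fun z hz => hlow z hz a ha.1 ha.2, fun b hb => ?_⟩
    by_contra hab
    have h1 : b ≤ y := hb hy
    have h2 : (a + b) / 2 ∈ S :=
      h y _ (sameCell_of_le (by linarith) fun f hf h3 h4 => by
        have := hamax f hf h4
        linarith).symm hy
    have := hb h2
    linarith
  · obtain ⟨b, hb⟩ := hb
    have h1 : b ≤ y := hb hy
    have h2 : b - 1 ∈ S :=
      h y _ (sameCell_of_le (by linarith) fun f hf _ h4 => hF ⟨f, by simp [hf, h4]⟩).symm hy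
    have := hb h2
    linarith

theorem TameAt.exists_isLUB {F : Finset ℚ} {S : Set ℚ} (h : TameAt F S) (hne : S.Nonempty)
    (hb : BddAbove S) : ∃ a, IsLUB S a := by
  obtain ⟨a, ha⟩ := h.neg.exists_isGLB hne.neg hb.neg
  exact ⟨-a, by simpa using ha.neg⟩

/-- A nonempty order-connected tame set as an interval. -/
def TameAt.interval {F : Finset ℚ} {S : Set ℚ} (h : TameAt F S) (hne : S.Nonempty)
    (hc : S.OrdConnected) : Interval :=
  ⟨S, hne, hc, h.exists_isGLB hne, h.exists_isLUB hne⟩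

theorem Interval.exists_tameAt (ρ : Interval) : ∃ F, TameAt F ρ.carrier := by
  classical
  have hL : ∃ F : Finset ℚ, ∀ x y, SameCell F x y → x ∈ ρ.carrier → ∃ z ∈ ρ.carrier, z ≤ y := by
    by_cases hb : BddBelow ρ.carrier
    · obtain ⟨a, ha⟩ := ρ.left_endpoint hb
      refine ⟨{a}, fun x y hxy hx => ?_⟩
      obtain ⟨h1, h2⟩ := hxy a (by simp)
      rcases (h1.1 (ha.1 hx)).eq_or_lt with h | h
      · exact ⟨x, hx, h ▸ h2.2 h.symm.le⟩
      · by_contra! hcon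
        exact absurd (ha.2 fun z hz => (hcon z hz).le) (not_le.2 h)
    · refine ⟨∅, fun x y _ _ => ?_⟩
      by_contra! hcon
      exact hb ⟨y, fun z hz => (hcon z hz).le⟩
  have hR : ∃ F : Finset ℚ, ∀ x y, SameCell F x y → x ∈ ρ.carrier → ∃ z ∈ ρ.carrier, y ≤ z := by
    by_cases hb : BddAbove ρ.carrier
    · obtain ⟨a, ha⟩ := ρ.right_endpoint hb
      refine ⟨{a}, fun x y hxy hx => ?_⟩
      obtain ⟨h1, h2⟩ := hxy a (by simp)
      rcases (h2.1 (ha.1 hx)).eq_or_lt with h | h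
      · exact ⟨x, hx, h ▸ h1.2 h.symm.le⟩
      · by_contra! hcon
        exact absurd (ha.2 fun z hz => (hcon z hz).le) (not_le.2 h)
    · refine ⟨∅, fun x y _ _ => ?_⟩
      by_contra! hcon
      exact hb ⟨y, fun z hz => (hcon z hz).le⟩
  obtain ⟨F, hF⟩ := hL
  obtain ⟨G, hG⟩ := hR
  refine ⟨F ∪ G, fun x y hxy hx => ?_⟩
  obtain ⟨z, hz, hzy⟩ := hF x y (hxy.mono Finset.subset_union_left) hx
  obtain ⟨w, hw, hyw⟩ := hG x y (hxy.mono Finset.subset_union_right) hx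
  exact ρ.ordConnected.out hz hw ⟨hzy, hyw⟩

theorem exists_tameAt_of_finite {ι : Type*} {A : Set ι} (hA : A.Finite) {p : ι → Set ℚ → Prop}
    (h : ∀ i ∈ A, ∃ F, ∀ S, p i S → TameAt F S) :
    ∃ F, ∀ i ∈ A, ∀ S, p i S → TameAt F S := by
  classical
  choose! F hF using h
  refine ⟨hA.toFinset.biUnion F, fun i hi S hS => (hF i hi S hS).mono ?_⟩
  exact Finset.subset_biUnion_of_mem F (hA.mem_toFinset.2 hi)

/-! ### Maximal intervals in tame sets -/

theorem TameAt.ordConnectedComponent {F : Finset ℚ} {S : Set ℚ} (h : TameAt F S) (x : ℚ) :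
    TameAt F (S.ordConnectedComponent x) := by
  intro y z hyz hy w hw
  rcases Set.uIcc_subset_uIcc_union_uIcc (b := y) hw with h1 | h1
  · exact hy h1
  · exact h y w (hyz.of_mem_uIcc h1) (hy Set.right_mem_uIcc)

theorem TameAt.carrier_eq_ordConnectedComponent {F : Finset ℚ} {S : Set ℚ} (h : TameAt F S)
    {ρ : Interval} (hρ : IsMaximalInterval (fun ρ => ρ.carrier ⊆ S) ρ) {t : ℚ}
    (ht : t ∈ ρ.carrier) : ρ.carrier = S.ordConnectedComponent t := by
  have := hρ.2 ((h.ordConnectedComponent t).interval ⟨t, Set.self_mem_ordConnectedComponent.2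
    (hρ.1 ht)⟩ inferInstance) Set.ordConnectedComponent_subset
    (have := ρ.ordConnected; Set.subset_ordConnectedComponent ht hρ.1)
  rw [← this]
  rfl

/-- A component of a tame set is tame, hence has endpoints as `Interval` requires. For sets such as
`{t | t ^ 2 < 2}` no maximal interval exists. -/
theorem TameAt.isMaximalInterval_ordConnectedComponent {F : Finset ℚ} {S : Set ℚ}
    (h : TameAt F S) {t : ℚ} (ht : t ∈ S) :
    ∃ ρ : Interval, ρ.carrier = S.ordConnectedComponent t ∧
      IsMaximalInterval (fun ρ => ρ.carrier ⊆ S) ρ := by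
  refine ⟨(h.ordConnectedComponent t).interval ⟨t, Set.self_mem_ordConnectedComponent.2 ht⟩
    inferInstance, rfl, Set.ordConnectedComponent_subset, fun ρ' h1 h2 => ?_⟩
  refine Interval.ext (Set.Subset.antisymm ?_ h2)
  have := ρ'.ordConnected
  exact Set.subset_ordConnectedComponent (h2 (Set.self_mem_ordConnectedComponent.2 ht)) h1

/-! ### Tameness of metric operators -/

theorem exists_mem_Ioo_lt (F : Finset ℚ) {u v : ℚ} (huv : u < v) :
    ∃ z ∈ Set.Ioo u v, ∀ f ∈ F, u < f → z < f := by
  classical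
  induction F using Finset.induction_on with
  | empty => exact ⟨(u + v) / 2, ⟨by linarith, by linarith⟩, by simp⟩
  | insert f F _ ih =>
    obtain ⟨z, hz, h⟩ := ih
    by_cases hf : u < f
    · refine ⟨min z ((u + f) / 2), ⟨lt_min hz.1 (by linarith), (min_le_left _ _).trans_lt hz.2⟩, ?_⟩
      intro g hg hug
      rcases Finset.mem_insert.1 hg with rfl | hg
      · exact (min_le_right _ _).trans_lt (by linarith)
      · exact (min_le_left _ _).trans_lt (h g hg hug)
    · refine ⟨z, hz, fun g hg hug => ?_⟩
      rcases Finset.mem_insert.1 hg with rfl | hg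
      · exact absurd hug hf
      · exact h g hg hug

theorem exists_mem_Ioo_gt (F : Finset ℚ) {u v : ℚ} (huv : u < v) :
    ∃ z ∈ Set.Ioo u v, ∀ f ∈ F, f < v → f < z := by
  obtain ⟨z, hz, h⟩ := exists_mem_Ioo_lt (-F) (neg_lt_neg huv)
  refine ⟨-z, ⟨by linarith [hz.2], by linarith [hz.1]⟩, fun f hf hfv => ?_⟩
  have := h (-f) (Finset.neg_mem_neg hf) (by linarith)
  linarith

/-- `K` is the union of the cells that meet `[u, v]`. It turns a condition on the pair `u, v` into
separate membership conditions on each of the two points, as needed for `𝓢` and `𝓤`. -/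
theorem TameAt.exists_cover_Ioo {F : Finset ℚ} {S : Set ℚ} (h : TameAt F S) {u v : ℚ}
    (huv : u < v) (hS : Set.Ioo u v ⊆ S) :
    ∃ K, TameAt F K ∧ u ∈ K ∧ v ∈ K ∧ ∀ a ∈ K, ∀ b ∈ K, Set.Ioo a b ⊆ S := by
  refine ⟨{w | ∃ z ∈ Set.Icc u v, SameCell F z w}, ?_, ⟨u, ⟨le_rfl, huv.le⟩, fun _ _ => by simp⟩,
    ⟨v, ⟨huv.le, le_rfl⟩, fun _ _ => by simp⟩, ?_⟩
  · rintro x y hxy ⟨z, hz, hzx⟩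
    exact ⟨z, hz, fun f hf => ⟨(hzx f hf).1.trans (hxy f hf).1, (hzx f hf).2.trans (hxy f hf).2⟩⟩
  · rintro a ⟨a', ha', haa'⟩ b ⟨b', hb', hbb'⟩ w ⟨haw, hwb⟩
    rcases le_or_gt w u with hwu | huw
    · have hw : SameCell F a' w := haa'.of_mem_uIcc (Set.mem_uIcc.2 (.inr ⟨haw.le, by
        linarith [ha'.1]⟩))
      rcases ha'.1.eq_or_lt with rfl | hua'
      -- The cell of `u` contains the smaller point `a`, so `u` is no breakpoint and its cell
      -- reaches into `Ioo u v`.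
      · obtain ⟨z, hz, hzF⟩ := exists_mem_Ioo_lt F huv
        refine h _ _ hw (h z _ (sameCell_of_le hz.1.le fun f hf h1 h2 => ?_).symm (hS hz))
        rcases h1.eq_or_lt with rfl | h1
        · linarith [(haa' u hf).1.1 le_rfl]
        · linarith [hzF f hf h1]
      · exact h _ _ (hw.symm.of_mem_uIcc (z := (u + a') / 2) (Set.mem_uIcc.2 (.inl
          ⟨by linarith, by linarith⟩))).symm (hS ⟨by linarith, by linarith [ha'.2]⟩)
    rcases le_or_gt v w with hvw | hwv
    · have hw : SameCell F b' w := hbb'.of_mem_uIcc (Set.mem_uIcc.2 (.inl ⟨by linarith [hb'.2],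
        hwb.le⟩))
      rcases hb'.2.eq_or_lt with rfl | hbv
      · obtain ⟨z, hz, hzF⟩ := exists_mem_Ioo_gt F huv
        refine h _ _ hw (h z _ (sameCell_of_le hz.2.le fun f hf h1 h2 => ?_) (hS hz))
        rcases h2.eq_or_lt with rfl | h2
        · linarith [(hbb' f hf).2.1 le_rfl]
        · linarith [hzF f hf h2]
      · exact h _ _ (hw.symm.of_mem_uIcc (z := (b' + v) / 2) (Set.mem_uIcc.2 (.inr
          ⟨by linarith, by linarith⟩))).symm (hS ⟨by linarith [hb'.1], by linarith⟩)
    exact hS ⟨huw, hwv⟩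

theorem exists_sub_mem_eq_add (ρ : Interval) (S : Set ℚ) :
    {t | ∃ t', t - t' ∈ ρ.carrier ∧ t' ∈ S} = S + ρ.carrier := by
  ext t
  constructor
  · rintro ⟨t', h1, h2⟩
    exact ⟨t', h2, t - t', h1, by simp⟩
  · rintro ⟨s, hs, r, hr, rfl⟩
    exact ⟨s, by simpa using hr, hs⟩

theorem exists_mem_sub_eq_add (ρ : Interval) (S : Set ℚ) :
    {t | ∃ t', t' - t ∈ ρ.carrier ∧ t' ∈ S} = S + -ρ.carrier := by
  ext t
  constructor
  · rintro ⟨t', h1, h2⟩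
    exact ⟨t', h2, t - t', by simpa using h1, by simp⟩
  · rintro ⟨s, hs, r, hr, rfl⟩
    exact ⟨s, by simpa using hr, hs⟩

theorem exists_tameAt_exists_sub_mem (ρ : Interval) (F : Finset ℚ) :
    ∃ G, ∀ S, TameAt F S → TameAt G {t | ∃ t', t - t' ∈ ρ.carrier ∧ t' ∈ S} := by
  obtain ⟨H, hH⟩ := ρ.exists_tameAt
  exact ⟨F + H, fun S hS => exists_sub_mem_eq_add ρ S ▸ hS.add hH⟩

theorem exists_tameAt_exists_mem_sub (ρ : Interval) (F : Finset ℚ) :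
    ∃ G, ∀ S, TameAt F S → TameAt G {t | ∃ t', t' - t ∈ ρ.carrier ∧ t' ∈ S} := by
  obtain ⟨H, hH⟩ := ρ.exists_tameAt
  exact ⟨F + -H, fun S hS => exists_mem_sub_eq_add ρ S ▸ hS.add hH.neg⟩

/-- By `TameAt.exists_cover_Ioo`, the operator is a union, over the tame sets `K` whose points have
only `S₁` strictly between them, of `K` intersected with a diamond of `S₂ ∩ K`; the case `t' = t` is
separate. The use of `min` and `max` covers `𝓢` and `𝓤` together. -/
theorem TameAt.since_of_diamond {F G : Finset ℚ} {R : ℚ → ℚ → Prop} (hFG : F ⊆ G)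
    (hrefl : ∀ S, TameAt F S → TameAt G {t | R t t ∧ t ∈ S})
    (hG : ∀ S, TameAt F S → TameAt G {t | ∃ t', R t t' ∧ t' ∈ S}) {S₁ S₂ : Set ℚ}
    (h₁ : TameAt F S₁) (h₂ : TameAt F S₂) :
    TameAt G {t | ∃ t', R t t' ∧ t' ∈ S₂ ∧ ∀ w ∈ Set.Ioo (min t t') (max t t'), w ∈ S₁} := by
  have : {t | ∃ t', R t t' ∧ t' ∈ S₂ ∧ ∀ w ∈ Set.Ioo (min t t') (max t t'), w ∈ S₁} =
      {t | R t t ∧ t ∈ S₂} ∪ {t | ∃ K : {K : Set ℚ // TameAt F K ∧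
        ∀ a ∈ K, ∀ b ∈ K, Set.Ioo a b ⊆ S₁}, t ∈ K.1 ∧ ∃ t', R t t' ∧ t' ∈ S₂ ∩ K.1} := by
    ext t
    constructor
    · rintro ⟨t', h1, h2, h3⟩
      rcases eq_or_ne t t' with rfl | hne
      · exact .inl ⟨h1, h2⟩
      · obtain ⟨K, hK, hu, hv, hKS⟩ := h₁.exists_cover_Ioo (min_lt_max.2 hne) h3
        refine .inr ⟨⟨K, hK, hKS⟩, ?_⟩
        rcases le_total t t' with h | h
        · rw [min_eq_left h] at hu
          rw [max_eq_right h] at hv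
          exact ⟨hu, t', h1, h2, hv⟩
        · rw [min_eq_right h] at hu
          rw [max_eq_left h] at hv
          exact ⟨hv, t', h1, h2, hu⟩
    · rintro (⟨h1, h2⟩ | ⟨⟨K, hK, hKS⟩, ht, t', h1, h2, h3⟩)
      · exact ⟨t, h1, h2, by simp⟩
      · refine ⟨t', h1, h2, fun w hw => ?_⟩
        rcases le_total t t' with h | h
        · rw [min_eq_left h, max_eq_right h] at hw
          exact hKS t ht t' h3 hw
        · rw [min_eq_right h, max_eq_left h] at hw
          exact hKS t' h3 t ht hw
  rw [this]
  exact (hrefl _ h₂).union (.exists fun K => (K.2.1.mono hFG).inter (hG _ (h₂.inter K.2.1)))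

theorem exists_tameAt_since (ρ : OpInterval) (F : Finset ℚ) :
    ∃ G, ∀ S₁ S₂, TameAt F S₁ → TameAt F S₂ → TameAt G {t | ∃ t', t - t' ∈ ρ.carrier ∧ t' ∈ S₂ ∧
      ∀ w ∈ Set.Ioo t' t, w ∈ S₁} := by
  classical
  obtain ⟨G, hG⟩ := exists_tameAt_exists_sub_mem ρ.toInterval F
  refine ⟨F ∪ G, fun S₁ S₂ h₁ h₂ => ?_⟩
  convert TameAt.since_of_diamond (G := F ∪ G) (R := fun t t' => t - t' ∈ ρ.carrier)
    Finset.subset_union_left (fun S hS x y hxy hx => ⟨by simpa using hx.1,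
      (hS.mono Finset.subset_union_left) x y hxy hx.2⟩)
    (fun S hS => (hG S hS).mono Finset.subset_union_right) h₁ h₂ using 5 with t t'
  refine and_congr_right fun h => ?_
  have := ρ.nonneg _ h
  rw [min_eq_right (by linarith), max_eq_left (by linarith)]

theorem exists_tameAt_until (ρ : OpInterval) (F : Finset ℚ) :
    ∃ G, ∀ S₁ S₂, TameAt F S₁ → TameAt F S₂ → TameAt G {t | ∃ t', t' - t ∈ ρ.carrier ∧ t' ∈ S₂ ∧
      ∀ w ∈ Set.Ioo t t', w ∈ S₁} := by
  classical
  obtain ⟨G, hG⟩ := exists_tameAt_exists_mem_sub ρ.toInterval F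
  refine ⟨F ∪ G, fun S₁ S₂ h₁ h₂ => ?_⟩
  convert TameAt.since_of_diamond (G := F ∪ G) (R := fun t t' => t' - t ∈ ρ.carrier)
    Finset.subset_union_left (fun S hS x y hxy hx => ⟨by simpa using hx.1,
      (hS.mono Finset.subset_union_left) x y hxy hx.2⟩)
    (fun S hS => (hG S hS).mono Finset.subset_union_right) h₁ h₂ using 5 with t t'
  refine and_congr_right fun h => ?_
  have := ρ.nonneg _ h
  rw [min_eq_left (by linarith), max_eq_right (by linarith)]

/-- The extensions of all relational atoms are unions of cells of one finite subdivision of the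
timeline. -/
def UniformlyTame {Pred : Type*} {C : Type*} (I : Interp Pred C) : Prop :=
  ∃ F, ∀ a, TameAt F {t | I a t}

/-- Diamonds are Minkowski sums with the operator interval or its negative, and boxes are dual to
them by complementation. One `F` serves all `σ`, so that all ground instances of a rule can be
treated at once. -/
theorem UniformlyTame.exists_tameAt_sat {Pred V C : Type*} {I : Interp Pred C}
    (hI : UniformlyTame I) (M : MAtom Pred (Term V C)) :
    ∃ F, ∀ σ : V → C, TameAt F {t | Sat I (M.subst σ) t} := by
  classical
  induction M
  · exact ⟨∅, fun σ x y _ _ => trivial⟩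
  · exact ⟨∅, fun σ x y _ h => h⟩
  next a =>
    obtain ⟨F, hF⟩ := hI
    exact ⟨F, fun σ => hF _⟩
  next ρ M ih =>
    obtain ⟨F, hF⟩ := ih
    obtain ⟨G, hG⟩ := exists_tameAt_exists_sub_mem ρ.toInterval F
    exact ⟨G, fun σ => hG _ (hF σ)⟩
  next ρ M ih =>
    obtain ⟨F, hF⟩ := ih
    obtain ⟨G, hG⟩ := exists_tameAt_exists_mem_sub ρ.toInterval F
    exact ⟨G, fun σ => hG _ (hF σ)⟩
  next ρ M ih =>
    obtain ⟨F, hF⟩ := ih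
    obtain ⟨G, hG⟩ := exists_tameAt_exists_sub_mem ρ.toInterval F
    refine ⟨G, fun σ => ?_⟩
    convert (hG _ (hF σ).compl).compl using 1
    ext t
    simp [MAtom.subst, MAtom.map, Sat]
  next ρ M ih =>
    obtain ⟨F, hF⟩ := ih
    obtain ⟨G, hG⟩ := exists_tameAt_exists_mem_sub ρ.toInterval F
    refine ⟨G, fun σ => ?_⟩
    convert (hG _ (hF σ).compl).compl using 1
    ext t
    simp [MAtom.subst, MAtom.map, Sat]
  next ρ M₁ M₂ ih₁ ih₂ =>
    obtain ⟨F₁, h₁⟩ := ih₁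
    obtain ⟨F₂, h₂⟩ := ih₂
    obtain ⟨G, hG⟩ := exists_tameAt_since ρ (F₁ ∪ F₂)
    exact ⟨G, fun σ => hG _ _ ((h₁ σ).mono Finset.subset_union_left)
      ((h₂ σ).mono Finset.subset_union_right)⟩
  next ρ M₁ M₂ ih₁ ih₂ =>
    obtain ⟨F₁, h₁⟩ := ih₁
    obtain ⟨F₂, h₂⟩ := ih₂
    obtain ⟨G, hG⟩ := exists_tameAt_until ρ (F₁ ∪ F₂)
    exact ⟨G, fun σ => hG _ _ ((h₁ σ).mono Finset.subset_union_left)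
      ((h₂ σ).mono Finset.subset_union_right)⟩

/-! ### Basic facts about satisfaction -/

section Semantics

variable {Pred V C : Type*}

theorem Sat.mono {I J : Interp Pred C} (hIJ : I ≤ J) {M : MAtom Pred C} {t : ℚ}
    (h : Sat I M t) : Sat J M t := by
  induction M generalizing t
  · trivial
  · exact h
  next a => exact hIJ a t h
  next ρ M ih => exact h.imp fun t' h => ⟨h.1, ih h.2⟩
  next ρ M ih => exact h.imp fun t' h => ⟨h.1, ih h.2⟩
  next ρ M ih => exact fun t' ht' => ih (h t' ht')
  next ρ M ih => exact fun t' ht' => ih (h t' ht')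
  next ρ M₁ M₂ ih₁ ih₂ => exact h.imp fun t' h => ⟨h.1, ih₂ h.2.1, fun w hw => ih₁ (h.2.2 w hw)⟩
  next ρ M₁ M₂ ih₁ ih₂ => exact h.imp fun t' h => ⟨h.1, ih₂ h.2.1, fun w hw => ih₁ (h.2.2 w hw)⟩

/-- Satisfaction is monotone in the interpretation, so the least model decides entailment. -/
theorem entails_iff {D : Set (Fact Pred C)} {M : MAtom Pred C} {ρ : Interval} :
    Entails D M ρ ↔ ∀ t ∈ ρ.carrier, Sat (leastModel D) M t :=
  ⟨fun h => h _ (represents_leastModel D).1,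
    fun h _ hI t ht => (h t ht).mono ((represents_leastModel D).2 hI)⟩

theorem entails_rel_iff {D : Set (Fact Pred C)} {a : RAtom Pred C} {ρ : Interval} :
    Entails D (.rel a) ρ ↔ ρ.carrier ⊆ {t | leastModel D a t} :=
  entails_iff

theorem entails_singleton_iff {f : Fact Pred C} {a : RAtom Pred C} {ρ : Interval} :
    Entails {f} (.rel a) ρ ↔ f.atom = a ∧ ρ.carrier ⊆ f.ivl.carrier := by
  rw [entails_rel_iff]
  constructor
  · intro h
    obtain ⟨t, ht⟩ := ρ.nonempty
    refine ⟨?_, fun t ht => ?_⟩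
    · obtain ⟨g, rfl, h, -⟩ := h ht
      exact h
    · obtain ⟨g, rfl, -, h⟩ := h ht
      exact h
  · rintro ⟨rfl, h⟩ t ht
    exact ⟨f, rfl, rfl, h ht⟩

theorem leastModel_union (D E : Set (Fact Pred C)) :
    leastModel (D ∪ E) = leastModel D ⊔ leastModel E := by
  funext a t
  refine propext ⟨?_, ?_⟩
  · rintro ⟨f, hf | hf, h⟩
    · exact .inl ⟨f, hf, h⟩
    · exact .inr ⟨f, hf, h⟩
  · rintro (⟨f, hf, h⟩ | ⟨f, hf, h⟩)
    · exact ⟨f, .inl hf, h⟩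
    · exact ⟨f, .inr hf, h⟩

theorem sat_congr_of_preds {I J : Interp Pred C} {M : MAtom Pred (Term V C)} {σ : V → C} {t : ℚ}
    (hIJ : ∀ a : RAtom Pred C, a.pred ∈ M.preds → ∀ t, I a t ↔ J a t) :
    Sat I (M.subst σ) t ↔ Sat J (M.subst σ) t := by
  induction M generalizing t
  · exact Iff.rfl
  · exact Iff.rfl
  next a => exact hIJ (a.map (Term.subst σ)) (by simp [MAtom.preds, RAtom.map]) t
  next ρ M ih => exact exists_congr fun t' => and_congr_right fun _ => ih hIJ
  next ρ M ih => exact exists_congr fun t' => and_congr_right fun _ => ih hIJ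
  next ρ M ih => exact forall₂_congr fun t' _ => ih hIJ
  next ρ M ih => exact forall₂_congr fun t' _ => ih hIJ
  next ρ M₁ M₂ ih₁ ih₂ =>
    exact exists_congr fun t' => and_congr_right fun _ => and_congr
      (ih₂ fun a ha => hIJ a (.inr ha)) (forall₂_congr fun _ _ => ih₁ fun a ha => hIJ a (.inl ha))
  next ρ M₁ M₂ ih₁ ih₂ =>
    exact exists_congr fun t' => and_congr_right fun _ => and_congr
      (ih₂ fun a ha => hIJ a (.inr ha)) (forall₂_congr fun _ _ => ih₁ fun a ha => hIJ a (.inl ha))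

theorem sat_congr_of_pastOnly {I J : Interp Pred C} {M : MAtom Pred (Term V C)} (hM : M.PastOnly)
    {σ : V → C} {t : ℚ} (hIJ : ∀ a, ∀ s ≤ t, I a s ↔ J a s) :
    Sat I (M.subst σ) t ↔ Sat J (M.subst σ) t := by
  induction M generalizing t
  · exact hM.elim
  · exact hM.elim
  next a => exact hIJ _ t le_rfl
  next ρ M ih =>
    refine exists_congr fun t' => and_congr_right fun h => ih hM fun a s hs => hIJ a s ?_
    linarith [ρ.nonneg _ h]
  next ρ M ih => exact hM.elim
  next ρ M ih =>
    refine forall₂_congr fun t' h => ih hM fun a s hs => hIJ a s ?_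
    linarith [ρ.nonneg _ h]
  next ρ M ih => exact hM.elim
  next ρ M₁ M₂ ih₁ ih₂ =>
    refine exists_congr fun t' => and_congr_right fun h => and_congr
      (ih₂ hM.2 fun a s hs => hIJ a s ?_)
      (forall₂_congr fun w hw => ih₁ hM.1 fun a s hs => hIJ a s (hs.trans hw.2.le))
    linarith [ρ.nonneg _ h]
  next ρ M₁ M₂ ih₁ ih₂ => exact hM.elim

/-! ### Rule heads -/

/-- If the head `H` holds at `s`, then its relational atom holds at each `t` with `H.Reach s t`. -/
def HAtom.Reach {T : Type*} : HAtom Pred T → ℚ → ℚ → Prop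
  | .top, _, _ => False
  | .rel _, s, t => t = s
  | .boxMinus ρ M, s, t => ∃ s', s - s' ∈ ρ.carrier ∧ M.Reach s' t
  | .boxPlus ρ M, s, t => ∃ s', s' - s ∈ ρ.carrier ∧ M.Reach s' t

theorem HAtom.reach_subst (H : HAtom Pred (Term V C)) (σ : V → C) :
    (H.subst σ).Reach = H.Reach := by
  funext s t
  induction H generalizing s with
  | top => rfl
  | rel a => rfl
  | boxMinus ρ M ih => exact congrArg Exists (funext fun s' => congrArg _ (ih s'))
  | boxPlus ρ M ih => exact congrArg Exists (funext fun s' => congrArg _ (ih s'))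

theorem HAtom.relAtom_subst (H : HAtom Pred (Term V C)) (σ : V → C) :
    (H.subst σ).relAtom = H.relAtom.map (RAtom.map (Term.subst σ)) := by
  induction H with
  | top => rfl
  | rel a => rfl
  | boxMinus ρ M ih => exact ih
  | boxPlus ρ M ih => exact ih

/-- A head is a nest of boxes around one atom, hence a conjunction of demands on that atom. This
gives the explicit form `I ⊔ conseq P I` of the immediate consequence operator. -/
theorem sat_head_iff {H : HAtom Pred C} {a : RAtom Pred C} (ha : H.relAtom = some a)
    {J : Interp Pred C} {s : ℚ} : Sat J H.toMAtom s ↔ ∀ t, H.Reach s t → J a t := by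
  induction H generalizing s with
  | top => cases ha
  | rel b =>
    obtain rfl := Option.some.inj ha
    exact ⟨fun h t ht => ht ▸ h, fun h => h s rfl⟩
  | boxMinus ρ M ih =>
    simp only [HAtom.toMAtom, Sat, HAtom.Reach, ih ha]
    exact ⟨fun h t ⟨s', h1, h2⟩ => h s' h1 t h2, fun h s' h1 t h2 => h t ⟨s', h1, h2⟩⟩
  | boxPlus ρ M ih =>
    simp only [HAtom.toMAtom, Sat, HAtom.Reach, ih ha]
    exact ⟨fun h t ⟨s', h1, h2⟩ => h s' h1 t h2, fun h s' h1 t h2 => h t ⟨s', h1, h2⟩⟩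

theorem sat_head_of_relAtom_eq_none {H : HAtom Pred C} (ha : H.relAtom = none)
    (J : Interp Pred C) (s : ℚ) : Sat J H.toMAtom s := by
  induction H generalizing s with
  | top => trivial
  | rel b => cases ha
  | boxMinus ρ M ih => exact fun t' _ => ih ha t'
  | boxPlus ρ M ih => exact fun t' _ => ih ha t'

theorem HAtom.FutureOnly.le_of_reach {T : Type*} {H : HAtom Pred T} (hH : H.FutureOnly) {s t : ℚ}
    (h : H.Reach s t) : s ≤ t := by
  induction H generalizing s with
  | top => exact h.elim
  | rel b => exact h.symm.le
  | boxMinus ρ M ih => exact hH.elim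
  | boxPlus ρ M ih =>
    obtain ⟨s', h1, h2⟩ := h
    linarith [ih hH h2, ρ.nonneg _ h1]

theorem HAtom.exists_tameAt_reach {T : Type*} (H : HAtom Pred T) (F : Finset ℚ) :
    ∃ G, ∀ X, TameAt F X → TameAt G {t | ∃ s ∈ X, H.Reach s t} := by
  induction H generalizing F with
  | top => exact ⟨∅, fun X _ x y _ ⟨s, _, h⟩ => h.elim⟩
  | rel a =>
    refine ⟨F, fun X hX => ?_⟩
    simpa [HAtom.Reach] using hX
  | boxMinus ρ M ih =>
    obtain ⟨F', hF'⟩ := exists_tameAt_exists_mem_sub ρ.toInterval F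
    obtain ⟨G, hG⟩ := ih F'
    refine ⟨G, fun X hX => ?_⟩
    convert hG _ (hF' X hX) using 1
    ext t
    exact ⟨fun ⟨s, hs, s', h1, h2⟩ => ⟨s', ⟨s, h1, hs⟩, h2⟩,
      fun ⟨s', ⟨s, h1, hs⟩, h2⟩ => ⟨s, hs, s', h1, h2⟩⟩
  | boxPlus ρ M ih =>
    obtain ⟨F', hF'⟩ := exists_tameAt_exists_sub_mem ρ.toInterval F
    obtain ⟨G, hG⟩ := ih F'
    refine ⟨G, fun X hX => ?_⟩
    convert hG _ (hF' X hX) using 1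
    ext t
    exact ⟨fun ⟨s, hs, s', h1, h2⟩ => ⟨s', ⟨s, h1, hs⟩, h2⟩,
      fun ⟨s', ⟨s, h1, hs⟩, h2⟩ => ⟨s, hs, s', h1, h2⟩⟩

/-- Each box adds or subtracts an interval, and Minkowski sums of convex sets are convex; so one
rule instance forces its atom on a single interval. -/
theorem HAtom.ordConnected_reach {T : Type*} (H : HAtom Pred T) {X : Set ℚ}
    (hX : X.OrdConnected) : {t | ∃ s ∈ X, H.Reach s t}.OrdConnected := by
  induction H generalizing X with
  | top => exact ⟨fun x ⟨s, _, h⟩ => h.elim⟩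
  | rel a => simpa [HAtom.Reach] using hX
  | boxMinus ρ M ih =>
    have h : {t | ∃ s, s - t ∈ ρ.carrier ∧ s ∈ X}.OrdConnected := by
      rw [exists_mem_sub_eq_add]
      exact (hX.convex.add ρ.ordConnected.convex.neg : Convex ℚ _).ordConnected
    convert ih h using 1
    ext t
    exact ⟨fun ⟨s, hs, s', h1, h2⟩ => ⟨s', ⟨s, h1, hs⟩, h2⟩,
      fun ⟨s', ⟨s, h1, hs⟩, h2⟩ => ⟨s, hs, s', h1, h2⟩⟩
  | boxPlus ρ M ih =>
    have h : {t | ∃ s, t - s ∈ ρ.carrier ∧ s ∈ X}.OrdConnected := by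
      rw [exists_sub_mem_eq_add]
      exact (hX.convex.add ρ.ordConnected.convex : Convex ℚ _).ordConnected
    convert ih h using 1
    ext t
    exact ⟨fun ⟨s, hs, s', h1, h2⟩ => ⟨s', ⟨s, h1, hs⟩, h2⟩,
      fun ⟨s', ⟨s, h1, hs⟩, h2⟩ => ⟨s, hs, s', h1, h2⟩⟩

/-! ### Direct consequences -/

/-- The relational atoms forced by the heads of the ground rule instances whose bodies hold
in `I`. -/
def conseq (P : Set (Rule Pred V C)) (I : Interp Pred C) : Interp Pred C := fun a t =>
  ∃ r ∈ P, ∃ σ : V → C, (r.head.subst σ).relAtom = some a ∧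
    ∃ s, (∀ M ∈ r.body, Sat I (M.subst σ) s) ∧ r.head.Reach s t

theorem conseq_mono {P Q : Set (Rule Pred V C)} (hPQ : P ⊆ Q) {I J : Interp Pred C}
    (hIJ : I ≤ J) : conseq P I ≤ conseq Q J :=
  fun _ _ ⟨r, hr, σ, ha, s, hs, ht⟩ =>
    ⟨r, hPQ hr, σ, ha, s, fun M hM => (hs M hM).mono hIJ, ht⟩

theorem immediateConsequence_eq (P : Set (Rule Pred V C)) (I : Interp Pred C) :
    immediateConsequence P I = I ⊔ conseq P I := by
  obtain ⟨⟨h1, h2⟩, h3⟩ := isLeast_immediateConsequence P I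
  refine le_antisymm (h3 ⟨le_sup_left, fun r hr σ s hs => ?_⟩) (sup_le h1 ?_)
  · cases ha : (r.head.subst σ).relAtom with
    | none => exact sat_head_of_relAtom_eq_none ha _ _
    | some a =>
      rw [sat_head_iff ha]
      intro t ht
      exact .inr ⟨r, hr, σ, ha, s, hs, by rwa [HAtom.reach_subst] at ht⟩
  · rintro a t ⟨r, hr, σ, ha, s, hs, ht⟩
    exact (sat_head_iff ha).1 (h2 r hr σ s hs) t (by rwa [HAtom.reach_subst])

theorem UniformlyTame.exists_tameAt_body {I : Interp Pred C} (hI : UniformlyTame I)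
    (L : List (MAtom Pred (Term V C))) :
    ∃ F, ∀ σ : V → C, TameAt F {t | ∀ M ∈ L, Sat I (M.subst σ) t} := by
  obtain ⟨F, hF⟩ := exists_tameAt_of_finite (A := {M | M ∈ L}) L.finite_toSet
    (p := fun M S => ∃ σ : V → C, S = {t | Sat I (M.subst σ) t}) (by
      intro M _
      obtain ⟨F, hF⟩ := hI.exists_tameAt_sat (V := V) M
      exact ⟨F, by rintro _ ⟨σ, rfl⟩; exact hF σ⟩)
  exact ⟨F, fun σ => .forall fun M => .forall fun hM => hF M hM _ ⟨σ, rfl⟩⟩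

theorem UniformlyTame.sup {I J : Interp Pred C} (hI : UniformlyTame I) (hJ : UniformlyTame J) :
    UniformlyTame (I ⊔ J) := by
  classical
  obtain ⟨F, hF⟩ := hI
  obtain ⟨G, hG⟩ := hJ
  exact ⟨F ∪ G, fun a => ((hF a).mono Finset.subset_union_left).union
    ((hG a).mono Finset.subset_union_right)⟩

theorem UniformlyTame.conseq {P : Set (Rule Pred V C)} (hP : P.Finite) {I : Interp Pred C}
    (hI : UniformlyTame I) : UniformlyTame (conseq P I) := by
  obtain ⟨F, hF⟩ := exists_tameAt_of_finite hP
    (p := fun r S => ∃ σ : V → C,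
      S = {t | ∃ s ∈ {s | ∀ M ∈ r.body, Sat I (M.subst σ) s}, r.head.Reach s t}) (by
      intro r _
      obtain ⟨F, hF⟩ := hI.exists_tameAt_body r.body
      obtain ⟨G, hG⟩ := r.head.exists_tameAt_reach F
      exact ⟨G, by rintro _ ⟨σ, rfl⟩; exact hG _ (hF σ)⟩)
  refine ⟨F, fun a x y hxy => ?_⟩
  rintro ⟨r, hr, σ, ha, s, hs, ht⟩
  obtain ⟨s', hs', ht'⟩ := hF r hr _ ⟨σ, rfl⟩ x y hxy ⟨s, hs, ht⟩
  exact ⟨r, hr, σ, ha, s', hs', ht'⟩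

/-! ### Finite support -/

/-- Only finitely many relational atoms hold somewhere. -/
def FiniteSupport (I : Interp Pred C) : Prop :=
  {a | ∃ t, I a t}.Finite

theorem FiniteSupport.sup {I J : Interp Pred C} (hI : FiniteSupport I) (hJ : FiniteSupport J) :
    FiniteSupport (I ⊔ J) :=
  (hI.union hJ).subset fun _ ⟨t, ht⟩ => ht.imp (fun h => ⟨t, h⟩) fun h => ⟨t, h⟩

/-- The constants in the relational atoms that hold somewhere. -/
def activeDomain (I : Interp Pred C) : Set C :=
  {c | ∃ a t, I a t ∧ c ∈ a.args}

theorem FiniteSupport.finite_activeDomain {I : Interp Pred C} (hI : FiniteSupport I) :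
    (activeDomain I).Finite := by
  refine (hI.biUnion fun a _ => a.args.finite_toSet).subset ?_
  rintro c ⟨a, t, h, hc⟩
  exact Set.mem_biUnion (x := a) ⟨t, h⟩ hc

/-- Boxes range over nonempty intervals and so yield a witness. Left operands of `𝓢` and `𝓤` do not,
being vacuous when `t' = t`. -/
theorem mem_activeDomain_of_sat {I : Interp Pred C} {M : MAtom Pred (Term V C)} {σ : V → C}
    {t : ℚ} (h : Sat I (M.subst σ) t) {y : V} (hy : y ∈ M.safeVars) :
    σ y ∈ activeDomain I := by
  induction M generalizing t
  · exact hy.elim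
  · exact hy.elim
  next a => exact ⟨_, t, h, List.mem_map.2 ⟨_, hy, rfl⟩⟩
  next ρ M ih =>
    obtain ⟨t', -, h⟩ := h
    exact ih h hy
  next ρ M ih =>
    obtain ⟨t', -, h⟩ := h
    exact ih h hy
  next ρ M ih =>
    obtain ⟨r, hr⟩ := ρ.nonempty
    exact ih (h (t - r) (by simpa using hr)) hy
  next ρ M ih =>
    obtain ⟨r, hr⟩ := ρ.nonempty
    exact ih (h (t + r) (by simpa using hr)) hy
  next ρ M₁ M₂ ih₁ ih₂ =>
    obtain ⟨t', -, h, -⟩ := h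
    exact ih₂ h hy
  next ρ M₁ M₂ ih₁ ih₂ =>
    obtain ⟨t', -, h, -⟩ := h
    exact ih₂ h hy

theorem HAtom.vars_eq_of_relAtom {H : HAtom Pred (Term V C)} {a : RAtom Pred (Term V C)}
    (ha : H.relAtom = some a) : H.vars = a.vars := by
  induction H with
  | top => cases ha
  | rel b =>
    obtain rfl := Option.some.inj ha
    rfl
  | boxMinus ρ M ih => exact ih ha
  | boxPlus ρ M ih => exact ih ha

theorem finite_map_subst {K : Set C} (hK : K.Finite) (L : List (Term V C)) :
    {l | ∃ σ : V → C, (∀ y, Term.var y ∈ L → σ y ∈ K) ∧ l = L.map (Term.subst σ)}.Finite := by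
  induction L with
  | nil => exact (Set.finite_singleton []).subset (by rintro _ ⟨σ, -, rfl⟩; rfl)
  | cons t L ih =>
    have ht : ∃ A : Set C, A.Finite ∧ ∀ σ : V → C, (∀ y, Term.var y ∈ t :: L → σ y ∈ K) →
        t.subst σ ∈ A := by
      cases t with
      | var y => exact ⟨K, hK, fun σ h => h y (by simp)⟩
      | const c => exact ⟨{c}, Set.finite_singleton c, fun σ _ => rfl⟩
    obtain ⟨A, hA, h⟩ := ht
    refine (Set.Finite.image2 List.cons hA ih).subset ?_
    rintro _ ⟨σ, hσ, rfl⟩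
    exact ⟨_, h σ hσ, _, ⟨σ, fun y hy => hσ y (by simp [hy]), rfl⟩, rfl⟩

/-- By safety, each head variable takes a value in the finite active domain whenever the body holds.
-/
theorem FiniteSupport.conseq {P : Set (Rule Pred V C)} (hP : IsProgram P) {I : Interp Pred C}
    (hI : FiniteSupport I) : FiniteSupport (conseq P I) := by
  refine (hP.1.biUnion (t := fun r => {a | ∃ b ∈ r.head.relAtom, a ∈ (RAtom.mk b.pred) ''
    {l | ∃ σ : V → C, (∀ y, Term.var y ∈ b.args → σ y ∈ activeDomain I) ∧
      l = b.args.map (Term.subst σ)}}) fun r _ => ?_).subset ?_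
  · cases r.head.relAtom with
    | none => simp
    | some b =>
      refine ((finite_map_subst hI.finite_activeDomain b.args).image (RAtom.mk b.pred)).subset ?_
      rintro a ⟨b', hb', ha⟩
      cases hb'
      exact ha
  · rintro a ⟨t, r, hr, σ, ha, s, hs, -⟩
    refine Set.mem_biUnion hr ?_
    rw [HAtom.relAtom_subst] at ha
    obtain ⟨b, hb, rfl⟩ := Option.map_eq_some_iff.1 ha
    refine ⟨b, hb, _, ⟨σ, fun y hy => ?_, rfl⟩, rfl⟩
    obtain ⟨M, hM, hyM⟩ := hP.2 r hr y (HAtom.vars_eq_of_relAtom hb ▸ hy)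
    exact mem_activeDomain_of_sat (hs M hM) hyM

theorem uniformlyTame_leastModel {D : Set (Fact Pred C)} (hD : D.Finite) :
    UniformlyTame (leastModel D) := by
  obtain ⟨F, hF⟩ := exists_tameAt_of_finite hD (p := fun f S => S = f.ivl.carrier) (by
    intro f _
    obtain ⟨F, hF⟩ := f.ivl.exists_tameAt
    exact ⟨F, by rintro _ rfl; exact hF⟩)
  refine ⟨F, fun a x y hxy => ?_⟩
  rintro ⟨f, hf, h, hx⟩
  exact ⟨f, hf, h, hF f hf _ rfl x y hxy hx⟩

theorem finiteSupport_leastModel {D : Set (Fact Pred C)} (hD : D.Finite) :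
    FiniteSupport (leastModel D) :=
  (hD.image Fact.atom).subset fun _ ⟨_, f, hf, h, _⟩ => ⟨f, hf, h⟩

/-! ### Coalescing -/

theorem mem_coalesce_iff {D₁ D₂ : Set (Fact Pred C)} {f : Fact Pred C} :
    f ∈ coalesce D₁ D₂ ↔
      IsMaximalInterval (fun ρ => ρ.carrier ⊆ {t | leastModel (D₁ ∪ D₂) f.atom t}) f.ivl := by
  simp only [coalesce, Set.mem_ofPred_eq, entails_rel_iff, IsMaximalInterval]
  refine and_congr_right fun _ => ⟨fun h ρ' h1 h2 => ?_, fun h ρ' h1 h2 => ?_⟩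
  · by_contra hne
    exact h ρ' (h2.ssubset_of_ne fun he => hne (Interval.ext he.symm)) h1
  · exact h1.ne (congrArg Interval.carrier (h ρ' h2 h1.subset)).symm

theorem exists_mem_coalesce {D₁ D₂ : Set (Fact Pred C)}
    (hT : UniformlyTame (leastModel (D₁ ∪ D₂))) {g : Fact Pred C} (hg : g ∈ D₁ ∪ D₂) :
    ∃ f ∈ coalesce D₁ D₂, f.atom = g.atom ∧ g.ivl.carrier ⊆ f.ivl.carrier := by
  obtain ⟨F, hF⟩ := hT
  obtain ⟨t, ht⟩ := g.ivl.nonempty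
  obtain ⟨ρ, hρ, hmax⟩ := (hF g.atom).isMaximalInterval_ordConnectedComponent
    (t := t) ⟨g, hg, rfl, ht⟩
  refine ⟨⟨g.atom, ρ⟩, mem_coalesce_iff.2 hmax, rfl, ?_⟩
  have := g.ivl.ordConnected
  exact hρ ▸ Set.subset_ordConnectedComponent ht fun s hs => ⟨g, hg, rfl, hs⟩

theorem leastModel_coalesce {D₁ D₂ : Set (Fact Pred C)}
    (hT : UniformlyTame (leastModel (D₁ ∪ D₂))) :
    leastModel (coalesce D₁ D₂) = leastModel (D₁ ∪ D₂) := by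
  funext a t
  refine propext ⟨?_, ?_⟩
  · rintro ⟨f, hf, rfl, ht⟩
    exact (mem_coalesce_iff.1 hf).1 ht
  · rintro ⟨g, hg, rfl, ht⟩
    obtain ⟨f, hf, h1, h2⟩ := exists_mem_coalesce hT hg
    exact ⟨f, hf, h1, h2 ht⟩

theorem finite_coalesce {D₁ D₂ : Set (Fact Pred C)}
    (hT : UniformlyTame (leastModel (D₁ ∪ D₂))) (hS : FiniteSupport (leastModel (D₁ ∪ D₂))) :
    (coalesce D₁ D₂).Finite := by
  obtain ⟨F, hF⟩ := hT
  refine Set.Finite.of_finite_image (f := fun f => (f.atom, f.ivl.carrier))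
    ((hS.prod (finite_tameAt F)).subset ?_) ?_
  · rintro _ ⟨f, hf, rfl⟩
    have h1 := mem_coalesce_iff.1 hf
    obtain ⟨t, ht⟩ := f.ivl.nonempty
    refine ⟨⟨t, h1.1 ht⟩, ?_⟩
    simp only [Set.mem_ofPred_eq]
    rw [(hF f.atom).carrier_eq_ordConnectedComponent h1 ht]
    exact (hF f.atom).ordConnectedComponent t
  · rintro ⟨a, ρ⟩ - ⟨b, ρ'⟩ - h
    obtain ⟨rfl, h⟩ := Prod.ext_iff.1 h
    exact congrArg _ (Interval.ext h)

/-- The facts of `coalesce D N` that contain no fact of `N` which is new for `D` are entailed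
by `D`. -/
theorem leastModel_coalesce_diff_le {D N : Set (Fact Pred C)}
    (hT : UniformlyTame (leastModel (D ∪ N))) :
    leastModel (coalesce D N \ {f ∈ coalesce D N | ∃ g ∈ newFacts N D,
      Entails {f} (.rel g.atom) g.ivl}) ≤ leastModel D := by
  rintro a t ⟨f, ⟨hf, hfΔ⟩, rfl, ht⟩
  have hmax := mem_coalesce_iff.1 hf
  obtain ⟨g, hg | hg, hgf, htg⟩ := hmax.1 ht
  · exact ⟨g, hg, hgf, htg⟩
  · obtain ⟨F, hF⟩ := hT
    -- `f` spans a whole component and meets `g`, hence contains it; a new `g` would therefore put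
    -- `f` into `Δ`.
    have hsub : g.ivl.carrier ⊆ f.ivl.carrier := by
      rw [(hF f.atom).carrier_eq_ordConnectedComponent hmax ht]
      have := g.ivl.ordConnected
      exact Set.subset_ordConnectedComponent htg fun s hs => ⟨g, .inr hg, hgf, hs⟩
    have h : Entails D (.rel g.atom) g.ivl := by
      by_contra hnew
      exact hfΔ ⟨hf, g, ⟨hg, hnew⟩, entails_singleton_iff.2 ⟨hgf.symm, hsub⟩⟩
    exact hgf ▸ entails_rel_iff.1 h htg

/-! ### Rule application -/

theorem leastModel_relDerived_le {P : Set (Rule Pred V C)} {D Δ : Set (Fact Pred C)} :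
    leastModel (relDerived P D Δ) ≤ conseq P (leastModel D) := by
  rintro a t ⟨f, ⟨r, hr, σ, ρ, ha, ⟨⟨τ, hτ⟩, -⟩, hmax⟩, rfl, ht⟩
  refine ⟨r, hr, σ, ha, ?_⟩
  -- The entailment is tested on the interpretation whose atoms hold only at the points that the
  -- head reaches from the common body interval.
  obtain ⟨s, hs, hst⟩ := hmax.1
    (fun _ t => ∃ s ∈ ⋂ i, (ρ i).carrier, (r.head.subst σ).Reach s t)
    (fun s hs => (sat_head_iff ha).2 fun t ht => ⟨s, hs, ht⟩) t ht
  rw [HAtom.reach_subst] at hst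
  refine ⟨s, fun M hM => ?_, hst⟩
  obtain ⟨i, hi, rfl⟩ := List.mem_iff_getElem.1 hM
  obtain ⟨h1, h2, -⟩ := hτ ⟨i, hi⟩
  simp only at h1 h2
  rw [← h1] at h2
  exact entails_iff.1 h2 s (Set.mem_iInter.1 hs _)

/-- For a body that holds at `s`, take the instance formed by the maximal intervals around `s`.
Either it is an instance relative to `Δ` and derives the wanted fact, or `D \ Δ` already entails all
of it. -/
theorem conseq_le_relDerived {P : Set (Rule Pred V C)} {D Δ : Set (Fact Pred C)}
    (hT : UniformlyTame (leastModel D)) :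
    conseq P (leastModel D) ≤
      leastModel (relDerived P D Δ) ⊔ conseq P (leastModel (D \ Δ)) := by
  classical
  rintro a t ⟨r, hr, σ, ha, s, hs, hst⟩
  have hmem : ∀ i, s ∈ {t | Sat (leastModel D) ((r.body.get i).subst σ) t} :=
    fun i => hs _ (r.body.get_mem i)
  have htame : ∀ i, ∃ F, TameAt F {t | Sat (leastModel D) ((r.body.get i).subst σ) t} := by
    intro i
    obtain ⟨F, hF⟩ := hT.exists_tameAt_sat (V := V) (r.body.get i)
    exact ⟨F, hF σ⟩
  choose F hF using htame
  choose ρ hρ hmax using fun i => (hF i).isMaximalInterval_ordConnectedComponent (hmem i)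
  by_cases hrel : ∃ i, ¬ Entails (D \ Δ) ((r.body.get i).subst σ) (ρ i)
  swap
  · push Not at hrel
    refine .inr ⟨r, hr, σ, ha, s, fun M hM => ?_, hst⟩
    obtain ⟨i, hi, rfl⟩ := List.mem_iff_getElem.1 hM
    refine entails_iff.1 (hrel ⟨i, hi⟩) s ?_
    rw [hρ]
    exact Set.self_mem_ordConnectedComponent.2 (hmem _)
  · left
    have hsX : s ∈ ⋂ i, (ρ i).carrier := Set.mem_iInter.2 fun i => by
      rw [hρ]
      exact Set.self_mem_ordConnectedComponent.2 (hmem _)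
    have hX : TameAt (Finset.univ.biUnion F) (⋂ i, (ρ i).carrier) := by
      intro x y hxy hx
      refine Set.mem_iInter.2 fun i => ?_
      have := Set.mem_iInter.1 hx i
      rw [hρ] at this ⊢
      exact (hF i).ordConnectedComponent s x y
        (hxy.mono (Finset.subset_biUnion_of_mem F (Finset.mem_univ i))) this
    obtain ⟨G, hG⟩ := r.head.exists_tameAt_reach (Finset.univ.biUnion F)
    have hc := r.head.ordConnected_reach
      (Set.ordConnected_iInter fun i => (ρ i).ordConnected)
    refine ⟨⟨a, (hG _ hX).interval ⟨t, s, hsX, hst⟩ hc⟩, ⟨r, hr, σ, ρ, ha, ⟨⟨σ, fun i => ⟨rfl, ?_⟩⟩,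
      hrel⟩, ?_, ?_⟩, rfl, s, hsX, hst⟩
    · refine ⟨entails_iff.2 (hmax i).1, fun ρ' h1 h2 => (hmax i).2 ρ' (entails_iff.1 h1) h2⟩
    · rintro I hI t ⟨s, hs, hst⟩
      exact (sat_head_iff ha).1 (hI s hs) t (by rwa [HAtom.reach_subst])
    · intro ρ' h1 h2
      refine Interval.ext (Set.Subset.antisymm (fun t ht => ?_) h2)
      obtain ⟨s, hs, hst⟩ := h1
        (fun _ t => ∃ s ∈ ⋂ i, (ρ i).carrier, (r.head.subst σ).Reach s t)
        (fun s hs => (sat_head_iff ha).2 fun t ht => ⟨s, hs, ht⟩) t ht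
      exact ⟨s, hs, by rwa [HAtom.reach_subst] at hst⟩

end Semantics

/-! ### Iterated direct consequences -/

section Procedure

variable {Pred V C : Type*}

theorem conseq_iff_exists_singleton {P : Set (Rule Pred V C)} {I : Interp Pred C}
    {a : RAtom Pred C} {t : ℚ} : conseq P I a t ↔ ∃ r ∈ P, conseq {r} I a t :=
  ⟨fun ⟨r, hr, h⟩ => ⟨r, hr, r, rfl, h⟩, fun ⟨_, hr, h⟩ =>
    conseq_mono (Set.singleton_subset_iff.2 hr) le_rfl a t h⟩

/-- The `k`th iterate of the immediate consequence operator on the least model of `D`. -/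
noncomputable def iter (P : Set (Rule Pred V C)) (D : Set (Fact Pred C)) (k : ℕ) : Interp Pred C :=
  (immediateConsequence P)^[k] (leastModel D)

variable {P : Set (Rule Pred V C)} {D : Set (Fact Pred C)}

theorem iter_succ (k : ℕ) : iter P D (k + 1) = iter P D k ⊔ conseq P (iter P D k) := by
  rw [iter, Function.iterate_succ_apply', immediateConsequence_eq]
  rfl

theorem iter_mono : Monotone (iter P D) :=
  monotone_nat_of_le_succ fun k => iter_succ (P := P) (D := D) k ▸ le_sup_left

theorem conseq_iter_le (k : ℕ) : conseq P (iter P D k) ≤ iter P D (k + 1) :=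
  iter_succ (P := P) (D := D) k ▸ le_sup_right

theorem uniformlyTame_iter (hP : P.Finite) (hD : D.Finite) (k : ℕ) :
    UniformlyTame (iter P D k) := by
  induction k with
  | zero => exact uniformlyTame_leastModel hD
  | succ k ih => exact iter_succ (P := P) (D := D) k ▸ ih.sup (ih.conseq hP)

theorem finiteSupport_iter (hP : IsProgram P) (hD : D.Finite) (k : ℕ) :
    FiniteSupport (iter P D k) := by
  induction k with
  | zero => exact finiteSupport_leastModel hD
  | succ k ih => exact iter_succ (P := P) (D := D) k ▸ ih.sup (ih.conseq hP)

/-- From a stage at which the rules in `P` derive nothing new, the iterates are constant. -/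
theorem iter_eq_of_le {k : ℕ} (h : iter P D (k + 1) = iter P D k) {j : ℕ} (hj : k ≤ j) :
    iter P D j = iter P D k := by
  induction j, hj using Nat.le_induction with
  | base => rfl
  | succ j hj ih => rw [iter_succ, ih, ← iter_succ, h]

/-! ### Stability of the non-recursive part -/

/-- `I` and `J` agree on the predicates that are non-recursive in `P`. -/
def AgreeNonRecursive (P : Set (Rule Pred V C)) (I J : Interp Pred C) : Prop :=
  ∀ a : RAtom Pred C, ¬ RecursivePred P a.pred → ∀ t, I a t ↔ J a t

theorem AgreeNonRecursive.sat_iff {I J : Interp Pred C} (h : AgreeNonRecursive P I J)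
    {M : MAtom Pred (Term V C)} (hM : NonRecursiveAtom P M) {σ : V → C} {t : ℚ} :
    Sat I (M.subst σ) t ↔ Sat J (M.subst σ) t :=
  sat_congr_of_preds fun a ha => h a (hM a.pred ha)

theorem pred_mem_of_relAtom_subst {H : HAtom Pred (Term V C)} {σ : V → C} {a : RAtom Pred C}
    (ha : (H.subst σ).relAtom = some a) : a.pred ∈ H.toMAtom.preds := by
  induction H with
  | top => cases ha
  | rel b =>
    cases ha
    simp [HAtom.toMAtom, MAtom.preds, RAtom.map]
  | boxMinus ρ M ih => exact ih ha
  | boxPlus ρ M ih => exact ih ha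

theorem nonRecursiveAtom_of_mem_body {r : Rule Pred V C} (hr : r ∈ P) {Q : Pred}
    (hQ : Q ∈ r.head.toMAtom.preds) (hrec : ¬ RecursivePred P Q) {M : MAtom Pred (Term V C)}
    (hM : M ∈ r.body) : NonRecursiveAtom P M := by
  rintro R hR ⟨S, hS, hSR⟩
  exact hrec ⟨S, hS, hSR.tail ⟨r, hr, ⟨M, hM, hR⟩, hQ⟩⟩

/-- Successors of recursive predicates are recursive, so non-recursive heads depend on non-recursive
predicates only. This part evolves autonomously, and one idle step freezes it. -/
theorem agreeNonRecursive_iter {k : ℕ}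
    (h : AgreeNonRecursive P (iter P D (k + 1)) (iter P D k)) {j : ℕ} (hj : k ≤ j) :
    AgreeNonRecursive P (iter P D j) (iter P D k) := by
  induction j, hj using Nat.le_induction with
  | base => exact fun _ _ _ => Iff.rfl
  | succ j hj ih =>
    refine fun a ha t => ⟨fun hat => ?_, iter_mono (hj.trans j.le_succ) a t⟩
    rw [iter_succ] at hat
    rcases hat with hat | ⟨r, hr, σ, hra, s, hs, hst⟩
    · exact (ih a ha t).1 hat
    · refine (h a ha t).1 (conseq_iter_le k a t ⟨r, hr, σ, hra, s, fun M hM => ?_, hst⟩)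
      exact (ih.sat_iff (nonRecursiveAtom_of_mem_body hr (pred_mem_of_relAtom_subst hra) ha hM)).1
        (hs M hM)

/-- The rule `r` derives nothing new from stage `k` on. -/
def Exhausted (P : Set (Rule Pred V C)) (D : Set (Fact Pred C)) (k : ℕ) (r : Rule Pred V C) :
    Prop :=
  ∀ j, k ≤ j → conseq {r} (iter P D j) ≤ iter P D j

theorem Exhausted.mono {k l : ℕ} (hkl : k ≤ l) {r : Rule Pred V C} (h : Exhausted P D k r) :
    Exhausted P D l r :=
  fun j hj => h j (hkl.trans hj)

theorem exhausted_of_nonRecursiveAtom {k : ℕ}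
    (h : ∀ j, k ≤ j → AgreeNonRecursive P (iter P D j) (iter P D k))
    {r : Rule Pred V C} (hr : r ∈ P) (hrec : NonRecursiveAtom P r.head.toMAtom) :
    Exhausted P D k r := by
  rintro j hj a t hat
  have ha : ¬ RecursivePred P a.pred := by
    obtain ⟨_, rfl, σ, hra, -⟩ := hat
    exact hrec _ (pred_mem_of_relAtom_subst hra)
  rw [h j hj a ha t, ← h (j + 1) (hj.trans j.le_succ) a ha t]
  exact conseq_iter_le j a t (conseq_mono (Set.singleton_subset_iff.2 hr) le_rfl a t hat)

/-- A frozen body atom that holds nowhere at stage `k` never will. -/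
theorem exhausted_of_inapplicable {k : ℕ}
    (h : ∀ j, k ≤ j → AgreeNonRecursive P (iter P D j) (iter P D k)) {E : Set (Fact Pred C)}
    (hE : leastModel E = iter P D k) {r : Rule Pred V C} (hr : Inapplicable P E r) :
    Exhausted P D k r := by
  rintro j hj a t ⟨_, rfl, σ, hra, s, hs, hst⟩
  obtain ⟨M, ⟨hM, hMrec⟩, hno⟩ := hr
  refine (hno σ s fun I hI => ?_).elim
  have := ((h j hj).sat_iff hMrec).1 (hs M hM)
  rw [← hE] at this
  exact this.mono ((represents_leastModel E).2 hI)

/-- The interval that consists of the time point `t`. -/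
def Interval.point (t : ℚ) : Interval :=
  ⟨{t}, Set.singleton_nonempty t, Set.ordConnected_singleton, fun _ => ⟨t, isGLB_singleton⟩,
    fun _ => ⟨t, isLUB_singleton⟩⟩

theorem Interval.rightEnd_point (t : ℚ) : (Interval.point t).rightEnd = ((t : ℝ) : EReal) := by
  simp [Interval.rightEnd, Interval.point]

theorem entails_point_iff {E : Set (Fact Pred C)} {M : MAtom Pred C} {t : ℚ} :
    Entails E M (Interval.point t) ↔ Sat (leastModel E) M t := by
  rw [entails_iff]
  exact ⟨fun h => h t rfl, fun h s hs => Set.mem_singleton_iff.1 hs ▸ h⟩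

theorem SameNonRecursiveFacts.agree {E₁ E₂ : Set (Fact Pred C)}
    (h : SameNonRecursiveFacts P E₁ E₂) :
    AgreeNonRecursive P (leastModel E₂) (leastModel E₁) := by
  intro a ha t
  have := h ⟨a, Interval.point t⟩ ha
  simp only [entails_point_iff] at this
  exact this.symm

/-- A body of `r` can hold only at some `s ≤ t_r`, because its frozen atoms hold nowhere later, and
it depends only on the timeline up to `s`, which is frozen as well. So whatever `r` derives later it
derives from stage `k`, and this is present from stage `k + 1` on. -/
theorem exhausted_of_completed {k : ℕ}
    (hnr : ∀ j, k ≤ j → AgreeNonRecursive P (iter P D j) (iter P D k)) {R : Set (Rule Pred V C)}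
    (hRP : R ⊆ P) (hR : ∀ r ∈ P, r ∉ R → Exhausted P D k r) (hfp : ForwardPropagating R)
    {E₁ E₂ : Set (Fact Pred C)} (h₁ : leastModel E₁ = iter P D k)
    (h₂ : leastModel E₂ = iter P D (k + 1)) {r : Rule Pred V C} (hr : r ∈ R)
    (hc : Completed P E₁ E₂ r) : Exhausted P D (k + 1) r := by
  -- The timeline up to `t_r` is frozen: rules outside `R` are exhausted, and a rule of `R` that
  -- derives an atom at `t` uses only the timeline up to `t`, so it did so at stage `k` already.
  -- `Completed`, applied to the interval `{t}`, then returns the atom to stage `k`.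
  have hagree : ∀ j, k ≤ j → ∀ a, ∀ t : ℚ, ((t : ℝ) : EReal) ≤ ruleBound P E₁ r →
      (iter P D j a t ↔ iter P D k a t) := by
    intro j hj
    induction j, hj using Nat.le_induction with
    | base => exact fun _ _ _ => Iff.rfl
    | succ j hj ih =>
      refine fun a t ht => ⟨fun hat => ?_, iter_mono (hj.trans j.le_succ) a t⟩
      rw [iter_succ] at hat
      rcases hat with hat | hat
      · exact (ih a t ht).1 hat
      obtain ⟨r', hr', hat⟩ := conseq_iff_exists_singleton.1 hat
      by_cases hr'R : r' ∈ R
      swap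
      · exact (ih a t ht).1 (hR r' hr' hr'R j hj a t hat)
      obtain ⟨_, rfl, σ, hra, s, hs, hst⟩ := hat
      obtain ⟨hhead, hbody⟩ := hfp _ hr'R
      have hle : s ≤ t := hhead.le_of_reach hst
      have hk : iter P D (k + 1) a t := by
        refine conseq_iter_le k a t ⟨_, hr', σ, hra, s, fun M hM => ?_, hst⟩
        refine (sat_congr_of_pastOnly (hbody M hM) fun b u hu => ih b u (le_trans ?_ ht)).1
          (hs M hM)
        exact_mod_cast hu.trans hle
      have := hc.2 ⟨a, Interval.point t⟩ (by rwa [Interval.rightEnd_point])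
      simp only [entails_point_iff, h₁, h₂] at this
      exact this.2 hk
  rintro j hj a t ⟨_, rfl, σ, hra, s, hs, hst⟩
  have hkj : k ≤ j := k.le_succ.trans hj
  refine iter_mono hj a t (conseq_iter_le k a t ⟨_, hRP hr, σ, hra, s, fun M hM => ?_, hst⟩)
  refine (sat_congr_of_pastOnly ((hfp _ hr).2 M hM) fun b u hu => hagree j hkj b u ?_).1 (hs M hM)
  -- Each atom of `S_r` holds at `s` already at stage `k`, so the interval `{s}` is among those
  -- whose right endpoints define `maxEnd`.
  refine le_sInf ?_
  rintro _ ⟨M', ⟨hM', hrec⟩, rfl⟩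
  refine le_sSup_of_le ⟨σ, Interval.point s, ?_, rfl⟩ ?_
  · rw [entails_point_iff, h₁]
    exact ((hnr j hkj).sat_iff hrec).1 (hs M' hM')
  · rw [Interval.rightEnd_point]
    exact_mod_cast hu

/-! ### The invariant of the procedure -/

/-- The invariant of the main loop upon completion of the `k`th iteration. -/
structure Invariant (P : Set (Rule Pred V C)) (D : Set (Fact Pred C)) (k : ℕ)
    (s : State Pred V C) : Prop where
  finite : s.data.Finite
  leastModel_data : leastModel s.data = iter P D k
  halted : s.halted → iter P D (k + 1) = iter P D k
  rules_subset : s.rules ⊆ P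
  old_le : conseq s.rules (leastModel (s.data \ s.delta)) ≤ iter P D k
  exhausted : ∀ r ∈ P, r ∉ s.rules → Exhausted P D k r
  agree : s.flag → ∀ j, k ≤ j → AgreeNonRecursive P (iter P D j) (iter P D k)

theorem invariant_initState (hvac : ∀ r ∈ P, ¬ r.VacuousBody) (hD : D.Finite) :
    Invariant P D 0 (initState P D) where
  finite := hD
  leastModel_data := rfl
  halted := False.elim
  rules_subset := subset_rfl
  old_le := by
    rintro a t ⟨r, hr, σ, -, s, hs, -⟩
    -- Initially `delta = data`, so there are no old facts and only a vacuous body could hold.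
    refine (hvac r hr ⟨σ, s, fun M hM => (hs M hM).mono ?_⟩).elim
    rintro b u ⟨f, ⟨hf, hf'⟩, -⟩
    exact hf' hf
  exhausted := fun _ hr h => (h hr).elim
  agree := False.elim

theorem Invariant.of_iter_eq {k : ℕ} {s : State Pred V C} (h : Invariant P D k s)
    (hk : iter P D (k + 1) = iter P D k) :
    Invariant P D (k + 1) { s with halted := True } where
  finite := h.finite
  leastModel_data := h.leastModel_data.trans hk.symm
  halted := fun _ => by rw [iter_eq_of_le hk (by omega), hk]
  rules_subset := h.rules_subset
  old_le := h.old_le.trans hk.ge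
  exhausted := fun r hr hrs => (h.exhausted r hr hrs).mono k.le_succ
  agree := fun hf j hj => hk ▸ h.agree hf j (k.le_succ.trans hj)

/-- Discarded rules contribute nothing by `exhausted`. For a rule still in use,
`conseq_le_relDerived` separates the relative instances from the old ones, which `old_le` covers. -/
theorem Invariant.leastModel_union {k : ℕ} {s : State Pred V C} (h : Invariant P D k s)
    (hP : P.Finite) (hD : D.Finite) :
    leastModel (s.data ∪ relDerived s.rules s.data s.delta) = iter P D (k + 1) := by
  rw [DatalogMTL.leastModel_union, h.leastModel_data]
  refine le_antisymm (sup_le (iter_mono k.le_succ) ?_) ?_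
  · refine (leastModel_relDerived_le.trans ?_).trans (conseq_iter_le k)
    rw [h.leastModel_data]
    exact conseq_mono h.rules_subset le_rfl
  · rw [iter_succ]
    refine sup_le le_sup_left fun a t hat => ?_
    obtain ⟨r, hr, hat⟩ := conseq_iff_exists_singleton.1 hat
    by_cases hrs : r ∈ s.rules
    · have hat := conseq_mono (Set.singleton_subset_iff.2 hrs) le_rfl a t hat
      rw [← h.leastModel_data] at hat
      rcases conseq_le_relDerived (Δ := s.delta)
        (h.leastModel_data ▸ uniformlyTame_iter hP hD k) a t hat with hat | hat
      · exact .inr hat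
      · exact .inl (h.old_le a t hat)
    · exact .inl (h.exhausted r hr hrs k le_rfl a t hat)

open Classical in
theorem Invariant.step {k : ℕ} {s : State Pred V C} (h : Invariant P D k s)
    (hP : IsProgram P) (hD : D.Finite) : Invariant P D (k + 1) (step P s) := by
  unfold DatalogMTL.step
  split_ifs with hhalt
  · have := h.of_iter_eq (h.halted hhalt)
    rwa [← eq_true hhalt] at this
  have hU := h.leastModel_union hP.1 hD
  let N := relDerived s.rules s.data s.delta
  let Cs := coalesce s.data N
  let Δ : Set (Fact Pred C) :=
    {f ∈ Cs | ∃ g ∈ newFacts N s.data, Entails {f} (.rel g.atom) g.ivl}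
  let switch : Prop := ¬ s.flag ∧ SameNonRecursiveFacts P s.data Cs
  let flag₁ : Prop := s.flag ∨ switch
  let rules₁ : Set (Rule Pred V C) :=
    if switch then {r ∈ recursiveFragment P | ¬ Inapplicable P s.data r} else s.rules
  let rules₂ : Set (Rule Pred V C) :=
    if flag₁ ∧ ForwardPropagating rules₁ then {r ∈ rules₁ | ¬ Completed P s.data Cs r}
    else rules₁
  change Invariant P D (k + 1)
    (if Δ = ∅ then { s with halted := True } else ⟨Cs, Δ, rules₂, flag₁, False⟩)
  have hT : UniformlyTame (leastModel (s.data ∪ N)) := hU ▸ uniformlyTame_iter hP.1 hD (k + 1)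
  have hCs : leastModel Cs = iter P D (k + 1) := (leastModel_coalesce hT).trans hU
  split_ifs with hΔ
  -- A new fact of `N` would lie in a coalesced fact, which would belong to `Δ`. So an empty `Δ`
  -- means that a fixpoint is reached.
  · refine h.of_iter_eq (le_antisymm ?_ (iter_mono k.le_succ))
    rw [← hU, DatalogMTL.leastModel_union, h.leastModel_data]
    refine sup_le le_rfl ?_
    rintro a t ⟨g, hg, rfl, ht⟩
    by_contra hnot
    obtain ⟨f, hf, hfg, hsub⟩ := exists_mem_coalesce hT (Set.mem_union_right s.data hg)
    have hmem : f ∈ Δ := by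
      refine ⟨hf, g, ⟨hg, fun hent => hnot ?_⟩, entails_singleton_iff.2 ⟨hfg, hsub⟩⟩
      rw [← h.leastModel_data]
      exact entails_rel_iff.1 hent ht
    rw [hΔ] at hmem
    exact hmem
  have hagree : flag₁ → ∀ j, k ≤ j → AgreeNonRecursive P (iter P D j) (iter P D k) := by
    rintro (hf | hf)
    · exact h.agree hf
    · intro j hj
      have := hf.2.agree
      rw [hCs, h.leastModel_data] at this
      exact agreeNonRecursive_iter this hj
  have hsub₁ : rules₁ ⊆ P := by
    intro r hr
    simp only [rules₁] at hr
    split_ifs at hr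
    · exact hr.1.1
    · exact h.rules_subset hr
  have hex₁ : ∀ r ∈ P, r ∉ rules₁ → Exhausted P D k r := by
    intro r hr hr₁
    simp only [rules₁] at hr₁
    split_ifs at hr₁ with hsw
    · have hagree := hagree (.inr hsw)
      by_cases hrec : NonRecursiveAtom P r.head.toMAtom
      · exact exhausted_of_nonRecursiveAtom hagree hr hrec
      · refine exhausted_of_inapplicable hagree h.leastModel_data ?_
        by_contra hin
        exact hr₁ ⟨⟨hr, hrec⟩, hin⟩
    · exact h.exhausted r hr hr₁
  have hsub₂ : rules₂ ⊆ rules₁ := by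
    intro r hr
    simp only [rules₂] at hr
    split_ifs at hr
    · exact hr.1
    · exact hr
  constructor
  · exact finite_coalesce hT (hU ▸ finiteSupport_iter hP hD (k + 1))
  · exact hCs
  · exact False.elim
  · exact hsub₂.trans hsub₁
  -- `Cs \ Δ` is entailed by the previous data, so its consequences were all obtained in this
  -- iteration.
  · refine le_trans (conseq_mono (hsub₂.trans hsub₁) ?_) (conseq_iter_le k)
    exact (leastModel_coalesce_diff_le hT).trans h.leastModel_data.le
  · intro r hr hr₂
    by_cases hr₁ : r ∈ rules₁
    swap
    · exact (hex₁ r hr hr₁).mono k.le_succ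
    simp only [rules₂] at hr₂
    split_ifs at hr₂ with hfp
    · refine exhausted_of_completed (hagree hfp.1) hsub₁ hex₁ hfp.2 h.leastModel_data hCs hr₁ ?_
      by_contra hc
      exact hr₂ ⟨hr₁, hc⟩
    · exact (hr₂ hr₁).elim
  · intro hf j hj a ha t
    rw [hagree hf j (k.le_succ.trans hj) a ha t, hagree hf (k + 1) k.le_succ a ha t]

theorem invariant_run (hP : IsProgram P) (hvac : ∀ r ∈ P, ¬ r.VacuousBody) (hD : D.Finite)
    (k : ℕ) : Invariant P D k (run P D k) := by
  induction k with
  | zero => exact invariant_initState hvac hD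
  | succ k ih =>
    rw [run, Function.iterate_succ_apply']
    exact ih.step hP hD

end Procedure

end DatalogMTL

theorem mainTheorem1 {Pred : Type*} {V : Type*} {C : Type*} [Nonempty C]
    (P : Set (DatalogMTL.Rule Pred V C)) (hP : DatalogMTL.IsProgram P)
    (hvac : ∀ r ∈ P, ¬ r.VacuousBody)
    (D : Set (DatalogMTL.Fact Pred C)) (hD : D.Finite) (k : ℕ) :
    (DatalogMTL.run P D k).data.Finite ∧
      DatalogMTL.Represents (DatalogMTL.run P D k).data
        ((DatalogMTL.immediateConsequence P)^[k] (DatalogMTL.leastModel D)) := by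
  have h := DatalogMTL.invariant_run hP hvac hD k
  have hrep := DatalogMTL.represents_leastModel (DatalogMTL.run P D k).data
  rw [h.leastModel_data] at hrep
  exact ⟨h.finite, hrep⟩
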